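/- Let $C$ be a compact connected Riemann surface, $p_\infty\in C$, and $z$ a local coordinate on an open neighbourhood $U_0$ of $p_\infty$ with $z(p_\infty)=0$. Let $L$ be a holomorphic line bundle on $C$ with a holomorphic frame $\epsilon$ over $U_0$ (for example, when $C$ has genus $g>0$, the degree $g-1$ bundle $L_{\Delta,e}$, obtained from the Riemann divisor class $\Delta$ by the twist with the flat bundle $L_e$, $e\in\mathbb C^g$, with the frame induced by $\sqrt{dz}$). Let $R=H^0(C,\mathcal O(*p_\infty))$ be the ring of meromorphic functions on $C$ that are holomorphic on $C\setminus\{p_\infty\}$, and let $H^0(C,L(*p_\infty))$ be the $R$-module of meromorphic sections of $L$ that are holomorphic on $C\setminus\{p_\infty\}$. For such a section $f$ and a point $P\in U_0\setminus\{p_\infty\}$ with $z(P)=w$, write $f(w)\in\mathbb C$ for the number with $f(P)=f(w)\,\epsilon(P)$. Let $M,N\ge 0$, let $p_1,\dots,p_N,q_1,\dots,q_M\in z(U_0)$ be distinct and non-zero, and let $(a_{j,i})$ be a complex $M\times N$ matrix. Put $$b_{N+j,i}=a_{j,i}\prod_{m\neq i}\frac{p_i^{-1}-p_m^{-1}}{q_j^{-1}-p_m^{-1}},\qquad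 b'_{N+j,i}=b_{N+j,i}\,p_i^{-1}q_j,$$ $$W_e=\Bigl\{f\in H^0(C,L(*p_\infty))\ \Big|\ f(p_i)=-\sum_{j=1}^M b'_{N+j,i}f(q_j),\ 1\le i\le N\Bigr\},\qquad R_e=\{f\in R\mid fW_e\subset W_e\}.$$ For $n\in\mathbb Z$ let $R_e(n)$ be the space of functions in $R_e$ with a pole of order at most $n$ at $p_\infty$. Let $A'=\bigoplus_{n\ge 0}R_e(n)$ and $C'=\mathrm{Proj}\,A'$; let $\varphi:\mathrm{Spec}\,R_e\to C'$ be the natural morphism, given on points by $\varphi(\mathcal P)=\bigoplus_{n\ge0}(\mathcal P\cap R_e(n))$; and let $p'_\infty=\bigoplus_{n\ge 0}R_e(n-1)\subset A'$, with $R_e(n-1)$ placed in degree $n$. Then $\dim R_e(n)/R_e(n-1)=1$ for all sufficiently large $n$, the ideal $p'_\infty$ is a point of $C'$, and: (i) $p'_\infty\notin\varphi(\mathrm{Spec}\,R_e)$. (ii) $C'=\varphi(\mathrm{Spec}\,R_e)\cup\{p'_\infty\}$. (iii) $C'\setminus\{p'_\infty\}$ is open in $C'$ and $H^0(C'\setminus\{p'_\infty\},\mathcal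 O_{C'})=R_e$; more precisely, pulling sections back along $\varphi$ is a ring isomorphism onto $R_e$. (iv) For every $m\ge 1$ and every $a\in R_e(m)$ with $a=z^{-m}+O(z^{-m+1})$, regarded as an element of degree $m$ of $A'$, one has $p'_\infty\in D'_+(a)=\{\mathcal P\in C'\mid a\notin\mathcal P\}$, and under the isomorphism $D'_+(a)\cong\mathrm{Spec}\,A'_{(a)}$, where $A'_{(a)}$ is the degree zero part of $A'[a^{-1}]$, the point $p'_\infty$ corresponds to a maximal ideal of $A'_{(a)}$. -/

import Mathlib

open scoped Manifold ContDiff DirectSum Topology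
open AlgebraicGeometry Bundle

universe u v

noncomputable section

namespace SingularCurve

/-! ### The graded ring, the scheme `Proj` and the morphism `φ` of a filtered ring -/

section Filtered

variable {S : Type u} [CommRing S] [Algebra ℂ S]

/-- An increasing multiplicative filtration of a `ℂ`-algebra, indexed by the integers. -/
class IsRingFiltration (F : ℤ → Submodule ℂ S) : Prop where
  mono : Monotone F
  one_mem : (1 : S) ∈ F 0
  mul_mem : ∀ {i j : ℤ} {x y : S}, x ∈ F i → y ∈ F j → x * y ∈ F (i + j)

variable (F : ℤ → Submodule ℂ S)

/-- The pieces of non-negative index of a filtration. -/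
abbrev natPart : ℕ → Submodule ℂ S := fun n => F (n : ℤ)

variable [IsRingFiltration F]

set_option linter.unusedSectionVars false

instance natPart_gradedMonoid : SetLike.GradedMonoid (natPart F) where
  one_mem := IsRingFiltration.one_mem
  mul_mem i j x y hx hy := by
    have := IsRingFiltration.mul_mem (F := F) hx hy
    simpa [natPart] using this

/-- The graded ring `⨁_{n ≥ 0} F n` (external direct sum, product `F i × F j → F (i + j)`). -/
def GradedSum : Type u := ⨁ n : ℕ, natPart F n

instance gradedSum_commRing : CommRing (GradedSum F) :=
  inferInstanceAs (CommRing (⨁ n : ℕ, natPart F n))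

/-- The component of degree `n` of an element of `⨁_{n ≥ 0} F n`. -/
def component (n : ℕ) : GradedSum F →+ natPart F n :=
  DFinsupp.evalAddMonoidHom (β := fun n : ℕ => natPart F n) n

/-- The inclusion of `F n` as the homogeneous component of degree `n`. -/
def inclusion (n : ℕ) : natPart F n →+ GradedSum F :=
  DirectSum.of (fun n : ℕ => natPart F n) n

/-- The element `x ∈ F n`, placed in degree `n`. -/
def homog (n : ℕ) (x : S) (hx : x ∈ F (n : ℤ)) : GradedSum F := inclusion F n ⟨x, hx⟩

/-- The homogeneous component of degree `n` of `⨁_{n ≥ 0} F n`. -/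
def grading (n : ℕ) : AddSubgroup (GradedSum F) := (inclusion F n).range

theorem homog_mem (n : ℕ) (x : S) (hx : x ∈ F (n : ℤ)) : homog F n x hx ∈ grading F n :=
  ⟨⟨x, hx⟩, rfl⟩

theorem homog_mul (m n : ℕ) (x y : S) (hx : x ∈ F (m : ℤ)) (hy : y ∈ F (n : ℤ))
    (hxy : x * y ∈ F ((m + n : ℕ) : ℤ)) :
    homog F m x hx * homog F n y hy = homog F (m + n) (x * y) hxy :=
  DirectSum.of_mul_of (A := fun n : ℕ => natPart F n) ⟨x, hx⟩ ⟨y, hy⟩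

theorem component_homog_self (n : ℕ) (x : S) (hx : x ∈ F (n : ℤ)) :
    component F n (homog F n x hx) = ⟨x, hx⟩ :=
  DirectSum.of_eq_same (β := fun n : ℕ => natPart F n) n ⟨x, hx⟩

theorem component_homog_of_ne {m n : ℕ} (h : m ≠ n) (x : S) (hx : x ∈ F (m : ℤ)) :
    component F n (homog F m x hx) = 0 :=
  DirectSum.of_eq_of_ne (β := fun n : ℕ => natPart F n) m n ⟨x, hx⟩ h.symm

theorem gradedSum_induction {C : GradedSum F → Prop} (y : GradedSum F) (h0 : C 0)
    (h1 : ∀ (n : ℕ) (x : S) (hx : x ∈ F (n : ℤ)), C (homog F n x hx))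
    (h2 : ∀ y y', C y → C y' → C (y + y')) : C y :=
  DirectSum.induction_on (β := fun n : ℕ => natPart F n) (motive := C) y h0
    (fun n x => h1 n x.1 x.2) h2

instance grading_gradedMonoid : SetLike.GradedMonoid (grading F) where
  one_mem := homog_mem F 0 1 IsRingFiltration.one_mem
  mul_mem := by
    rintro i j _ _ ⟨x, rfl⟩ ⟨y, rfl⟩
    exact ⟨_, (homog_mul F i j x y x.2 y.2
      (SetLike.GradedMul.mul_mem (A := natPart F) x.2 y.2)).symm⟩

/-- Splitting an element of `⨁_{n ≥ 0} F n` into its homogeneous components. -/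
def splitting : GradedSum F →+ ⨁ n : ℕ, grading F n :=
  DirectSum.toAddMonoid (β := fun n : ℕ => natPart F n) fun n =>
    (DirectSum.of (fun n => grading F n) n).comp (inclusion F n).rangeRestrict

theorem splitting_homog (n : ℕ) (x : S) (hx : x ∈ F (n : ℤ)) :
    splitting F (homog F n x hx) =
      DirectSum.of (fun n => grading F n) n ⟨homog F n x hx, homog_mem F n x hx⟩ :=
  DirectSum.toAddMonoid_of (β := fun n : ℕ => natPart F n) _ n ⟨x, hx⟩

instance grading_decomposition : DirectSum.Decomposition (grading F) where
  decompose' := splitting F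
  left_inv y := by
    induction y using gradedSum_induction with
    | h0 => simp
    | h1 n x hx => rw [splitting_homog, DirectSum.coeAddMonoidHom_of]
    | h2 y y' hy hy' => rw [map_add, map_add, hy, hy']
  right_inv y := by
    induction y using DirectSum.induction_on with
    | zero => simp
    | of n x =>
      obtain ⟨_, x, rfl⟩ := x
      rw [DirectSum.coeAddMonoidHom_of]
      exact splitting_homog F n x.1 x.2
    | add y y' hy hy' => rw [map_add, map_add, hy, hy']

instance grading_gradedRing : GradedRing (grading F) where

theorem natPart_mul_pred {m n : ℕ} {x y : S} (hx : x ∈ F (m : ℤ)) (hy : y ∈ F ((n : ℤ) - 1)) :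
    x * y ∈ F (((m + n : ℕ) : ℤ) - 1) := by
  have := IsRingFiltration.mul_mem (F := F) hx hy
  rwa [← add_sub_assoc, ← Nat.cast_add] at this

/-- The ideal `⨁_{n ≥ 0} F (n - 1)`, with `F (n - 1) ⊆ F n` placed in degree `n`. -/
def inftyIdeal : Ideal (GradedSum F) where
  carrier := {y | ∀ n : ℕ, (component F n y : S) ∈ F ((n : ℤ) - 1)}
  zero_mem' n := by simp
  add_mem' {x y} hx hy n := by
    simpa using (F ((n : ℤ) - 1)).add_mem (hx n) (hy n)
  smul_mem' c y hy := by
    have key : ∀ (m k : ℕ) (x z : S) (hx : x ∈ F (m : ℤ)) (hz : z ∈ F (k : ℤ)),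
        z ∈ F ((k : ℤ) - 1) → ∀ n : ℕ,
        (component F n (homog F m x hx * homog F k z hz) : S) ∈ F ((n : ℤ) - 1) := by
      intro m k x z hx hz hz' n
      rw [homog_mul F m k x z hx hz (SetLike.GradedMul.mul_mem (A := natPart F) hx hz)]
      by_cases h : m + k = n
      · subst h
        rw [component_homog_self]
        exact natPart_mul_pred F hx hz'
      · rw [component_homog_of_ne F h]
        simp
    classical
    intro n
    have hsum : y = ∑ k ∈ DFinsupp.support (β := fun n : ℕ => natPart F n) y,
        homog F k (component F k y) (component F k y).2 :=
      (DirectSum.sum_support_of (β := fun n : ℕ => natPart F n) y).symm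
    have hy' : ∀ k : ℕ, (component F k y : S) ∈ F ((k : ℤ) - 1) := hy
    induction c using gradedSum_induction with
    | h0 => simp
    | h1 m x hx =>
      rw [hsum, smul_eq_mul, Finset.mul_sum, map_sum, AddSubmonoidClass.coe_finsetSum]
      exact Submodule.sum_mem _ fun k _ => key m k x _ hx _ (hy' k) n
    | h2 c c' h h' =>
      rw [add_smul, map_add]
      exact (F ((n : ℤ) - 1)).add_mem h h'

/-- The ring homomorphism `⨁_{n ≥ 0} F n → S` that sums the homogeneous components. -/
def sumHom : GradedSum F →+* S := DirectSum.coeRingHom (natPart F)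

theorem sumHom_homog (n : ℕ) (x : S) (hx : x ∈ F (n : ℤ)) : sumHom F (homog F n x hx) = x :=
  DirectSum.coeRingHom_of (natPart F) n ⟨x, hx⟩

theorem one_mem_one : (1 : S) ∈ F ((1 : ℕ) : ℤ) :=
  IsRingFiltration.mono (by simp) (IsRingFiltration.one_mem (F := F))

theorem map_irrelevant_eq_top :
    (HomogeneousIdeal.irrelevant (grading F)).toIdeal.map
      (((Scheme.ΓSpecIso (.of S)).inv.hom).comp (sumHom F)) = ⊤ := by
  rw [Ideal.eq_top_iff_one]
  have h : homog F 1 1 (one_mem_one F) ∈ (HomogeneousIdeal.irrelevant (grading F)).toIdeal := by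
    change homog F 1 1 (one_mem_one F) ∈ HomogeneousIdeal.irrelevant (grading F)
    rw [HomogeneousIdeal.mem_irrelevant_iff, GradedRing.proj_apply,
      DirectSum.decompose_of_mem_ne _ (homog_mem F 1 1 (one_mem_one F)) one_ne_zero]
  have h2 := Ideal.mem_map_of_mem (((Scheme.ΓSpecIso (.of S)).inv.hom).comp (sumHom F)) h
  rwa [RingHom.comp_apply, sumHom_homog, map_one] at h2

/-- The morphism `φ : Spec S ⟶ Proj (⨁_{n ≥ 0} F n)` that belongs to `sumHom`. On points it is
`𝔭 ↦ ⨁_n (𝔭 ∩ F n)`, see `homog_mem_specToProj_iff`. -/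
def specToProj : Spec (.of S) ⟶ Proj (grading F) :=
  Proj.fromOfGlobalSections (grading F)
    (((Scheme.ΓSpecIso (.of S)).inv.hom).comp (sumHom F)) (map_irrelevant_eq_top F)

theorem homog_mem_specToProj_iff_of_pos (P : Spec (.of S)) (n : ℕ) (hn : 0 < n) (x : S)
    (hx : x ∈ F (n : ℤ)) :
    homog F n x hx ∈ (specToProj F P).asHomogeneousIdeal ↔ x ∈ P.asIdeal := by
  have h := Proj.fromOfGlobalSections_preimage_basicOpen (grading F)
    (((Scheme.ΓSpecIso (.of S)).inv.hom).comp (sumHom F)) (map_irrelevant_eq_top F) hn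
    (homog_mem F n x hx)
  rw [RingHom.comp_apply, sumHom_homog] at h
  have h2 : P ∈ (specToProj F) ⁻¹ᵁ Proj.basicOpen (grading F) (homog F n x hx) ↔
      P ∈ (Spec (.of S)).basicOpen ((Scheme.ΓSpecIso (.of S)).inv.hom x) := by
    rw [← h]; rfl
  rw [basicOpen_eq_of_affine' , Scheme.Hom.mem_preimage, Proj.mem_basicOpen] at h2
  refine not_iff_not.1 (h2.trans ?_)
  simp
  exact Iff.rfl

theorem homog_mem_specToProj_iff (P : Spec (.of S)) (n : ℕ) (x : S) (hx : x ∈ F (n : ℤ)) :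
    homog F n x hx ∈ (specToProj F P).asHomogeneousIdeal ↔ x ∈ P.asIdeal := by
  have hx' : 1 * x ∈ F ((1 + n : ℕ) : ℤ) :=
    SetLike.GradedMul.mul_mem (A := natPart F) (one_mem_one F) hx
  have h1 : homog F 1 1 (one_mem_one F) ∉ (specToProj F P).asHomogeneousIdeal := by
    rw [homog_mem_specToProj_iff_of_pos F P 1 one_pos]
    exact fun h => P.isPrime.ne_top ((Ideal.eq_top_iff_one _).2 h)
  have h2 := homog_mem_specToProj_iff_of_pos F P (1 + n) (by omega) (1 * x) hx'
  rw [← homog_mul F 1 n 1 x (one_mem_one F) hx hx', one_mul] at h2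
  rw [← h2]
  refine ⟨fun h => Ideal.mul_mem_left _ _ h, fun h => ?_⟩
  exact ((specToProj F P).isPrime.mem_or_mem h).resolve_left h1

/-- An element of `S`, as a section of the structure sheaf of `Spec S` over an open set. -/
def specSection (V : (Spec (.of S)).Opens) : S →+* Γ(Spec (.of S), V) :=
  ((Spec (.of S)).presheaf.map (CategoryTheory.homOfLE le_top).op).hom.comp
    (Scheme.ΓSpecIso (.of S)).inv.hom

/-- `dim F n / F (n - 1)`. -/
def stepDim (n : ℤ) : ℕ := Module.finrank ℂ (F n ⧸ (F (n - 1)).submoduleOf (F n))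

end Filtered

/-! ### Compact Riemann surfaces and the stabilizer ring -/

section Surface

set_option linter.unusedSectionVars false

variable {C : Type u} [TopologicalSpace C] [ChartedSpace ℂ C]

/-- A local coordinate `z` of a Riemann surface around the point `p`, with `z(p) = 0`. -/
structure LocalCoordinate (p : C) where
  chart : OpenPartialHomeomorph C ℂ
  mem_maximalAtlas : chart ∈ IsManifold.maximalAtlas 𝓘(ℂ) ω C
  mem_source : p ∈ chart.source
  map_center : chart p = 0

variable [T2Space C] {p : C} (z : LocalCoordinate p)

/-- The open Riemann surface `C ∖ {p}`. -/
def punctured (p : C) : TopologicalSpace.Opens C := ⟨{p}ᶜ, isOpen_compl_singleton⟩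

open Classical in
/-- A function on `C ∖ {p}` near `p`, as a function of the value `w` of the local coordinate. -/
def localExpr (f : punctured p → ℂ) (w : ℂ) : ℂ :=
  if h : z.chart.symm w ∈ punctured p then f ⟨z.chart.symm w, h⟩ else 0

theorem eventually_mem_punctured : ∀ᶠ w in 𝓝[≠] (0 : ℂ), z.chart.symm w ∈ punctured p := by
  have h0 : (0 : ℂ) ∈ z.chart.target := z.map_center ▸ z.chart.map_source z.mem_source
  filter_upwards [nhdsWithin_le_nhds (z.chart.open_target.mem_nhds h0), self_mem_nhdsWithin]
    with w hw hne h
  apply hne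
  have h' : z.chart.symm w = p := h
  rw [Set.mem_singleton_iff, ← z.chart.right_inv hw, h', z.map_center]

theorem localExpr_add (f g : punctured p → ℂ) :
    localExpr z (f + g) = localExpr z f + localExpr z g := by
  ext w
  simp only [localExpr, Pi.add_apply]
  split_ifs <;> simp

theorem localExpr_mul (f g : punctured p → ℂ) :
    localExpr z (f * g) = localExpr z f * localExpr z g := by
  ext w
  simp only [localExpr, Pi.mul_apply]
  split_ifs <;> simp

theorem localExpr_const (c : ℂ) :
    localExpr z (fun _ => c) =ᶠ[𝓝[≠] 0] fun _ => c := by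
  filter_upwards [eventually_mem_punctured z] with w hw
  simp [localExpr, hw]

/-- The ring `R = H⁰(C, 𝒪(*p))` of meromorphic functions on `C` that are holomorphic
on `C ∖ {p}`. -/
def affineRing : Subalgebra ℂ (punctured p → ℂ) where
  carrier := {f | MDifferentiable 𝓘(ℂ) 𝓘(ℂ) f ∧ MeromorphicAt (localExpr z f) 0}
  mul_mem' {f g} hf hg := ⟨hf.1.mul hg.1, by
    rw [localExpr_mul]
    exact hf.2.mul hg.2⟩
  add_mem' {f g} hf hg := ⟨hf.1.add hg.1, by
    rw [localExpr_add]
    exact hf.2.add hg.2⟩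
  algebraMap_mem' c := ⟨mdifferentiable_const,
    (MeromorphicAt.const c 0).congr (localExpr_const z c).symm⟩

variable {L : C → Type v} [TopologicalSpace (TotalSpace ℂ L)] [∀ x, AddCommGroup (L x)]
  [∀ x, Module ℂ (L x)] [∀ x, TopologicalSpace (L x)] [FiberBundle ℂ L] [VectorBundle ℂ ℂ L]

/-- A section of the line bundle `L` over `C ∖ {p}` is holomorphic. -/
def IsHolomorphicSection (s : ∀ x : punctured p, L x) : Prop :=
  MDifferentiable 𝓘(ℂ) (𝓘(ℂ).prod 𝓘(ℂ)) fun x : punctured p => TotalSpace.mk' ℂ (x : C) (s x)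

theorem isHolomorphicSection_iff (s : ∀ x : punctured p, L x) :
    IsHolomorphicSection s ↔ ∀ x₀ : punctured p, MDifferentiableAt 𝓘(ℂ) 𝓘(ℂ)
      (fun x : punctured p =>
        (trivializationAt ℂ L (x₀ : C) (TotalSpace.mk' ℂ (x : C) (s x))).2) x₀ := by
  refine forall_congr' fun x₀ => ?_
  rw [mdifferentiableAt_totalSpace]
  refine and_iff_right ?_
  exact (contMDiff_subtype_val (n := 1)).mdifferentiable one_ne_zero x₀

theorem eventually_mem_baseSet (x₀ : punctured p) :
    ∀ᶠ x : punctured p in 𝓝 x₀, (x : C) ∈ (trivializationAt ℂ L (x₀ : C)).baseSet :=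
  continuous_subtype_val.continuousAt.eventually
    ((trivializationAt ℂ L (x₀ : C)).open_baseSet.mem_nhds
      (FiberBundle.mem_baseSet_trivializationAt' (x₀ : C)))

theorem IsHolomorphicSection.zero : IsHolomorphicSection (0 : ∀ x : punctured p, L x) := by
  rw [isHolomorphicSection_iff]
  intro x₀
  refine (mdifferentiableAt_const (c := (0 : ℂ))).congr_of_eventuallyEq ?_
  filter_upwards [eventually_mem_baseSet (L := L) x₀] with x hx
  exact ((trivializationAt ℂ L (x₀ : C)).linear ℂ hx).map_zero

theorem IsHolomorphicSection.add {s t : ∀ x : punctured p, L x} (hs : IsHolomorphicSection s)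
    (ht : IsHolomorphicSection t) : IsHolomorphicSection (s + t) := by
  rw [isHolomorphicSection_iff] at hs ht ⊢
  intro x₀
  refine ((hs x₀).add (ht x₀)).congr_of_eventuallyEq ?_
  filter_upwards [eventually_mem_baseSet (L := L) x₀] with x hx
  exact ((trivializationAt ℂ L (x₀ : C)).linear ℂ hx).map_add _ _

theorem IsHolomorphicSection.smul {f : punctured p → ℂ} {s : ∀ x : punctured p, L x}
    (hf : MDifferentiable 𝓘(ℂ) 𝓘(ℂ) f) (hs : IsHolomorphicSection s) :
    IsHolomorphicSection fun x => f x • s x := by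
  rw [isHolomorphicSection_iff] at hs ⊢
  intro x₀
  refine ((hf x₀).smul (hs x₀)).congr_of_eventuallyEq ?_
  filter_upwards [eventually_mem_baseSet (L := L) x₀] with x hx
  exact ((trivializationAt ℂ L (x₀ : C)).linear ℂ hx).map_smul _ _

/-- With respect to the local frame `e` of `L` on the domain of the coordinate `z`, the section `s`
is `A(z) e` there, where `A` is meromorphic at `0`. -/
def IsExpansion (e : ∀ x : C, L x) (s : ∀ x : punctured p, L x) (A : ℂ → ℂ) : Prop :=
  MeromorphicAt A 0 ∧ ∀ x : punctured p, (x : C) ∈ z.chart.source →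
    s x = A (z.chart x) • e x

/-- `H⁰(C, L(*p))`: the meromorphic sections of `L` that are holomorphic on `C ∖ {p}`. -/
def meromorphicSections (e : ∀ x : C, L x) : Submodule ℂ (∀ x : punctured p, L x) where
  carrier := {s | IsHolomorphicSection s ∧ ∃ A, IsExpansion z e s A}
  zero_mem' := ⟨IsHolomorphicSection.zero, 0, MeromorphicAt.const 0 0, by simp⟩
  add_mem' := by
    rintro s t ⟨hs, A, hA, hsA⟩ ⟨ht, B, hB, htB⟩
    exact ⟨hs.add ht, A + B, hA.add hB, fun x hx => by simp [hsA x hx, htB x hx, add_smul]⟩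
  smul_mem' := by
    rintro c s ⟨hs, A, hA, hsA⟩
    exact ⟨hs.smul mdifferentiable_const, fun w => c * A w, (MeromorphicAt.const c 0).mul hA,
      fun x hx => by simp [hsA x hx, mul_smul]⟩

/-- The parameters of the vertex operators: distinct non-zero values `p₁, …, p_N, q₁, …, q_M` of the
local coordinate, and an `M × N` matrix `(a_{j,i})`. -/
structure VertexData (M N : ℕ) where
  p : Fin N → ℂ
  q : Fin M → ℂ
  a : Matrix (Fin M) (Fin N) ℂ
  p_mem : ∀ i, p i ∈ z.chart.target
  q_mem : ∀ j, q j ∈ z.chart.target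
  p_ne_zero : ∀ i, p i ≠ 0
  q_ne_zero : ∀ j, q j ≠ 0
  distinct : Function.Injective (Sum.elim p q)

variable {z} {M N : ℕ} (D : VertexData z M N) (e : ∀ x : C, L x)

/-- The lower block of the matrix `B`: `b j i` is `b_{N+j,i}`. -/
def VertexData.b (j : Fin M) (i : Fin N) : ℂ :=
  D.a j i * ∏ m ∈ Finset.univ.erase i,
    ((D.p i)⁻¹ - (D.p m)⁻¹) / ((D.q j)⁻¹ - (D.p m)⁻¹)

/-- `b' j i` is `b'_{N+j,i} = b_{N+j,i} p_i⁻¹ q_j`. -/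
def VertexData.b' (j : Fin M) (i : Fin N) : ℂ := D.b j i * ((D.p i)⁻¹ * D.q j)

/-- The relations `A(p_i) = - ∑_j b'_{N+j,i} A(q_j)`, `1 ≤ i ≤ N`. -/
def VertexData.Relations (A : ℂ → ℂ) : Prop :=
  ∀ i, A (D.p i) = -∑ j, D.b' j i * A (D.q j)

/-- The space `W_e` of all sections in `H⁰(C, L(*p))` that satisfy the relations. -/
def vertexSpace : Submodule ℂ (∀ x : punctured p, L x) where
  carrier := {s | s ∈ meromorphicSections z e ∧ ∃ A, IsExpansion z e s A ∧ D.Relations A}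
  zero_mem' := ⟨zero_mem _, 0, ⟨MeromorphicAt.const 0 0, by simp⟩, fun i => by simp⟩
  add_mem' := by
    rintro s t ⟨hs, A, ⟨hA, hsA⟩, hA'⟩ ⟨ht, B, ⟨hB, htB⟩, hB'⟩
    refine ⟨add_mem hs ht, A + B,
      ⟨hA.add hB, fun x hx => by simp [hsA x hx, htB x hx, add_smul]⟩, fun i => ?_⟩
    simp only [Pi.add_apply, hA' i, hB' i, mul_add, Finset.sum_add_distrib, neg_add]
  smul_mem' := by
    rintro c s ⟨hs, A, ⟨hA, hsA⟩, hA'⟩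
    refine ⟨Submodule.smul_mem _ c hs, fun w => c * A w, ⟨(MeromorphicAt.const c 0).mul hA,
      fun x hx => by simp [hsA x hx, mul_smul]⟩, fun i => ?_⟩
    simp only [hA' i, mul_neg, Finset.mul_sum]
    congr 1
    exact Finset.sum_congr rfl fun j _ => by ring

/-- The stabilizer `R_e = {f ∈ R | f W_e ⊆ W_e}` of `W_e` in `R`. -/
def stabilizerRing : Subalgebra ℂ (punctured p → ℂ) where
  carrier := {f | f ∈ affineRing z ∧
    ∀ s ∈ vertexSpace D e, (fun x => f x • s x) ∈ vertexSpace D e}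
  mul_mem' {f g} hf hg := ⟨mul_mem hf.1 hg.1, fun s hs => by
    simpa [mul_smul] using hf.2 _ (hg.2 s hs)⟩
  add_mem' {f g} hf hg := ⟨add_mem hf.1 hg.1, fun s hs => by
    have := add_mem (hf.2 s hs) (hg.2 s hs)
    convert this using 1
    ext x
    simp [add_smul]⟩
  algebraMap_mem' c := ⟨Subalgebra.algebraMap_mem _ c, fun s hs =>
    Submodule.smul_mem _ c hs⟩

theorem stabilizerRing_meromorphicAt (f : stabilizerRing D e) :
    MeromorphicAt (localExpr z f.1) 0 := f.2.1.2

/-- `R_e(n)`: the functions in `R_e` with a pole of order at most `n` at `p`, for an integer `n`. -/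
def poleFiltration (n : ℤ) : Submodule ℂ (stabilizerRing D e) where
  carrier := {f | ((-n : ℤ) : WithTop ℤ) ≤ meromorphicOrderAt (localExpr z f.1) 0}
  zero_mem' := by
    have h : meromorphicOrderAt (localExpr z (0 : punctured p → ℂ)) 0 = ⊤ := by
      rw [meromorphicOrderAt_eq_top_iff]
      exact localExpr_const z 0
    change _ ≤ meromorphicOrderAt (localExpr z (0 : punctured p → ℂ)) 0
    rw [h]
    exact le_top
  add_mem' {f g} hf hg := by
    change _ ≤ meromorphicOrderAt (localExpr z (f.1 + g.1)) 0
    rw [localExpr_add]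
    exact (le_min hf hg).trans (meromorphicOrderAt_add (stabilizerRing_meromorphicAt D e f)
      (stabilizerRing_meromorphicAt D e g))
  smul_mem' c f hf := by
    have h : ((0 : ℤ) : WithTop ℤ) ≤ meromorphicOrderAt (localExpr z fun _ => c) 0 := by
      classical
      rw [meromorphicOrderAt_congr (localExpr_const z c), meromorphicOrderAt_const]
      split_ifs <;> simp
    change _ ≤ meromorphicOrderAt (localExpr z ((fun _ => c) * f.1)) 0
    rw [localExpr_mul, meromorphicOrderAt_mul
      ((MeromorphicAt.const c 0).congr (localExpr_const z c).symm)
      (stabilizerRing_meromorphicAt D e f)]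
    simpa using add_le_add h hf

theorem mem_poleFiltration_iff (n : ℤ) (f : stabilizerRing D e) :
    f ∈ poleFiltration D e n ↔
      ((-n : ℤ) : WithTop ℤ) ≤ meromorphicOrderAt (localExpr z f.1) 0 := Iff.rfl

instance poleFiltration_isRingFiltration : IsRingFiltration (poleFiltration D e) where
  mono m n h f hf := by
    rw [mem_poleFiltration_iff] at hf ⊢
    refine le_trans ?_ hf
    exact_mod_cast neg_le_neg h
  one_mem := by
    classical
    change _ ≤ meromorphicOrderAt (localExpr z fun _ => (1 : ℂ)) 0
    rw [meromorphicOrderAt_congr (localExpr_const z 1), meromorphicOrderAt_const]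
    simp
  mul_mem {i j f g} hf hg := by
    rw [mem_poleFiltration_iff] at hf hg
    change _ ≤ meromorphicOrderAt (localExpr z (f.1 * g.1)) 0
    rw [localExpr_mul, meromorphicOrderAt_mul (stabilizerRing_meromorphicAt D e f)
      (stabilizerRing_meromorphicAt D e g)]
    have := add_le_add hf hg
    rw [← WithTop.coe_add] at this
    convert this using 2
    ring

/-- `f = z^{-m} + O(z^{-m+1})` near `p`. -/
def HasLeadingTerm (f : stabilizerRing D e) (m : ℕ) : Prop :=
  ((1 - (m : ℤ) : ℤ) : WithTop ℤ) ≤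
    meromorphicOrderAt (fun w => localExpr z f.1 w - w ^ (-(m : ℤ))) 0

/-- The grading of `A' = ⨁_{n ≥ 0} R_e(n)`. -/
abbrev curveGrading : ℕ → AddSubgroup (GradedSum (poleFiltration D e)) :=
  grading (poleFiltration D e)

/-- The curve `C' = Proj A'`. -/
abbrev singularCurve : Scheme := Proj (curveGrading D e)

/-- The morphism `φ : Spec R_e ⟶ C'`. -/
abbrev specToCurve : Spec (.of (stabilizerRing D e)) ⟶ singularCurve D e :=
  specToProj (poleFiltration D e)

end Surface

end SingularCurve

end

open SingularCurve

/-! Everything rests on one analytic fact and one algebraic mechanism.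

Analytic fact: for every large `n` the ring `R_e` contains a function with a pole of order exactly
`n` at `p`. A function of `R` that vanishes at all `p_i` and `q_j` lies in `R_e`, because it makes
both sides of every relation zero (`mem_stabilizerRing_of_vanishing`). So it suffices to find
functions of `R` with prescribed large pole order and finitely many prescribed zeros. Cut off `z⁻ⁿ`
near `p`; its `∂̄` extends to a smooth `(0,1)`-form on `C`, and a solution `u` of `∂̄u =` this form
would correct it to an element of `R`. The equation is solvable under finitely many linear
conditions (`CutoffSystem.exists_solution`): patching planar Cauchy transforms gives a parametrix
whose error `T` has a smooth kernel, and the range of `1 + T` contains the kernel of a map to a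
finite dimensional space. If infinitely many orders were missing, a linear relation between their
obstructions would produce a function whose pole order is one of the missing ones
(`finite_setOf_gaps`). The same linear algebra, applied to values at points, imposes the zeros
(`exists_vanishing_of_large`).

Algebraic mechanism: two functions of the same pole order are proportional up to lower order, and
pole orders add under multiplication; `IsPoleFiltration` records this. It gives one-dimensional
steps and the primality of `p'_∞`. Let `T` here denote `1 ∈ R_e(1)` in degree one (`degreeOne`).
Multiplication by `T` is the inclusion `R_e(n) ⊆ R_e(n+1)`, so a degree zero fraction `x / Tⁿ` is
just the function `x`. Hence `A'_{(T)} = R_e`, and `φ` is the chart `D₊(T)` of `C'` up to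
isomorphism (`exists_isIso_specToProj_eq`). The only point outside this chart is `p'_∞`: a
homogeneous prime that contains `T` contains everything of non-maximal order, and comparing leading
terms of powers shows that it contains nothing else (`IsPoleFiltration.eq_inftyPoint_of_mem`). This
gives (i), (ii) and (iii). For (iv), a fraction in `A'_{(a)}` outside the prime of `p'_∞` is
invertible modulo that prime, with a constant as inverse, again by comparing leading terms. -/

noncomputable section

namespace SingularCurve

/-! ### The Cauchy transform in the plane: it inverts `∂̄` on compactly supported functions. -/

section CauchyTransform

open MeasureTheory Complex Set Filter

/-- The Wirtinger derivative `∂f/∂z̄`. -/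
def dbar (f : ℂ → ℂ) (z : ℂ) : ℂ := (fderiv ℝ f z 1 + I * fderiv ℝ f z I) / 2

/-- The Cauchy transform `z ↦ π⁻¹ ∫ g(t) / (z - t)`. -/
def cauchyTransform (g : ℂ → ℂ) (z : ℂ) : ℂ := (Real.pi : ℂ)⁻¹ * ∫ t, g t * (z - t)⁻¹

/-- The exponent `1` of the singularity is smaller than the real dimension `2`. -/
theorem locallyIntegrable_inv : LocallyIntegrable (fun z : ℂ => z⁻¹) volume := by
  refine locallyIntegrable_of_norm_le_rpow (C := 1) (α := 1) (by simp) (by simp) ?_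
    (by fun_prop)
  exact Eventually.of_forall fun z => by simp [Real.rpow_neg_one]

/-- Fundamental theorem of calculus along the ray through `w`. The ray is parametrized
isometrically, so compact support survives the restriction. -/
theorem integral_radial_deriv {f : ℂ → ℂ} (hf : ContDiff ℝ 1 f) (hc : HasCompactSupport f)
    (w : ℂ) (hw : ‖w‖ = 1) : ∫ r in Ioi (0 : ℝ), fderiv ℝ f (r * w) w = -f 0 := by
  have hd : ∀ r : ℝ, HasDerivAt (fun r : ℝ => f (r * w)) (fderiv ℝ f (r * w) w) r := fun r => by
    have h1 : HasDerivAt (fun r : ℝ => (r : ℂ) * w) w r := by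
      simpa using (Complex.ofRealCLM.hasDerivAt (x := r)).mul_const w
    exact ((hf.differentiable one_ne_zero) _).hasFDerivAt.comp_hasDerivAt r h1
  have hemb : Topology.IsClosedEmbedding fun r : ℝ => (r : ℂ) * w := by
    refine Isometry.isClosedEmbedding (Isometry.of_dist_eq fun x y => ?_)
    rw [dist_eq_norm, ← sub_mul, norm_mul, hw, mul_one, ← ofReal_sub, norm_real, Real.dist_eq,
      Real.norm_eq_abs]
  have hcomp : HasCompactSupport fun r : ℝ => f (r * w) := hc.comp_isClosedEmbedding hemb
  have hint : Integrable fun r : ℝ => fderiv ℝ f (r * w) w := by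
    refine Continuous.integrable_of_hasCompactSupport ?_ ?_
    · exact ((hf.continuous_fderiv one_ne_zero).comp hemb.continuous).clm_apply continuous_const
    · exact (((hc.fderiv ℝ).comp_isClosedEmbedding hemb)).comp_left
        (g := fun L : ℂ →L[ℝ] ℂ => L w) (by simp)
  have := integral_Ioi_of_hasDerivAt_of_tendsto' (a := (0 : ℝ)) (fun x _ => hd x)
    hint.integrableOn (hcomp.is_zero_at_infty.mono_left atTop_le_cocompact)
  simpa using this

/-- The integrand is the angular derivative of `f / r` on the circle of radius `r`, hence integrates
to zero by periodicity. -/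
theorem integral_circular_deriv {f : ℂ → ℂ} (hf : ContDiff ℝ 1 f) (r : ℝ) (hr : 0 < r) :
    ∫ θ in Ioo (-Real.pi) Real.pi,
      fderiv ℝ f (r * (Real.cos θ + Real.sin θ * I)) (I * (Real.cos θ + Real.sin θ * I)) = 0 := by
  have hd : ∀ θ : ℝ, HasDerivAt (fun θ : ℝ => (r : ℂ)⁻¹ * f (r * (Real.cos θ + Real.sin θ * I)))
      (fderiv ℝ f (r * (Real.cos θ + Real.sin θ * I))
        (I * (Real.cos θ + Real.sin θ * I))) θ := fun θ => by
    have h1 : HasDerivAt (fun θ : ℝ => (r : ℂ) * (Real.cos θ + Real.sin θ * I))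
        (r * (I * (Real.cos θ + Real.sin θ * I))) θ := by
      have := (((Real.hasDerivAt_cos θ).ofReal_comp.add
        ((Real.hasDerivAt_sin θ).ofReal_comp.mul_const I)).const_mul (r : ℂ))
      refine this.congr_deriv ?_
      push_cast
      linear_combination -(r : ℂ) * Complex.sin θ * I_sq
    have h2 := (((hf.differentiable one_ne_zero) _).hasFDerivAt.comp_hasDerivAt θ h1).const_mul
      (r : ℂ)⁻¹
    refine h2.congr_deriv ?_
    have h3 : ((r : ℂ) * (I * (Real.cos θ + Real.sin θ * I))) =
      r • (I * (Real.cos θ + Real.sin θ * I)) := by simp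
    have hr' : (r : ℂ) ≠ 0 := by exact_mod_cast hr.ne'
    rw [h3, map_smul, Complex.real_smul, inv_mul_cancel_left₀ hr']
  rw [← integral_Ioc_eq_integral_Ioo, ← intervalIntegral.integral_of_le (by
    linarith [Real.pi_pos]), intervalIntegral.integral_eq_sub_of_hasDerivAt (fun θ _ => hd θ)]
  · simp
  · refine Continuous.intervalIntegrable ?_ _ _
    exact ((hf.continuous_fderiv one_ne_zero).comp (by fun_prop)).clm_apply (by fun_prop)

theorem integrableOn_polar {F : ℂ → ℂ → ℂ} (hF : Continuous fun x : ℂ × ℂ => F x.1 x.2)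
    {R : ℝ} (hR : ∀ z w, R < ‖z‖ → F z w = 0) :
    IntegrableOn (fun x : ℝ × ℝ => F (x.1 * (Real.cos x.2 + Real.sin x.2 * I))
      (Real.cos x.2 + Real.sin x.2 * I)) (Ioi 0 ×ˢ Ioo (-Real.pi) Real.pi) := by
  have hcont : Continuous (fun x : ℝ × ℝ => F (x.1 * (Real.cos x.2 + Real.sin x.2 * I))
      (Real.cos x.2 + Real.sin x.2 * I)) :=
    hF.comp (f := fun x : ℝ × ℝ => ((x.1 * (Real.cos x.2 + Real.sin x.2 * I) : ℂ),
      (Real.cos x.2 + Real.sin x.2 * I : ℂ))) (by fun_prop)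
  have h1 : IntegrableOn (fun x : ℝ × ℝ => F (x.1 * (Real.cos x.2 + Real.sin x.2 * I))
      (Real.cos x.2 + Real.sin x.2 * I)) (Icc 0 R ×ˢ Icc (-Real.pi) Real.pi) :=
    hcont.continuousOn.integrableOn_compact (isCompact_Icc.prod isCompact_Icc)
  refine IntegrableOn.of_forall_sdiff_eq_zero h1
    (measurableSet_Ioi.prod measurableSet_Ioo) ?_
  rintro ⟨r, θ⟩ ⟨⟨hr, hθ⟩, h⟩
  apply hR
  have hr' : (0 : ℝ) < r := hr
  have : ‖(Real.cos θ + Real.sin θ * I : ℂ)‖ = 1 := by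
    rw [ofReal_cos, ofReal_sin, norm_cos_add_sin_mul_I]
  rw [norm_mul, this, mul_one, norm_real, Real.norm_of_nonneg hr'.le]
  by_contra hlt
  exact h ⟨⟨hr'.le, not_lt.1 hlt⟩, ⟨hθ.1.le, hθ.2.le⟩⟩

/-- The Cauchy–Pompeiu formula for a compactly supported function. -/
theorem integral_dbar_mul_inv {f : ℂ → ℂ} (hf : ContDiff ℝ 1 f) (hc : HasCompactSupport f) :
    ∫ t, dbar f t * t⁻¹ = -Real.pi * f 0 := by
  obtain ⟨R, hR⟩ : ∃ R : ℝ, ∀ z, R < ‖z‖ → fderiv ℝ f z = 0 := by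
    obtain ⟨R, hR⟩ := (hc.fderiv ℝ).isCompact.isBounded.exists_norm_le
    exact ⟨R, fun z hz => image_eq_zero_of_notMem_tsupport fun h => (hR z h).not_gt hz⟩
  have hcd := hf.continuous_fderiv one_ne_zero
  let e : ℝ → ℂ := fun θ => Real.cos θ + Real.sin θ * I
  have he : ∀ θ, ‖e θ‖ = 1 := fun θ => by
    simp only [e]
    rw [ofReal_cos, ofReal_sin, norm_cos_add_sin_mul_I]
  have hA : IntegrableOn (fun x : ℝ × ℝ => fderiv ℝ f (x.1 * e x.2) (e x.2))
      (Ioi 0 ×ˢ Ioo (-Real.pi) Real.pi) :=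
    integrableOn_polar (F := fun z w => fderiv ℝ f z w)
      ((hcd.comp continuous_fst).clm_apply continuous_snd) (R := R)
      fun z w hz => by simp [hR z hz]
  have hB : IntegrableOn (fun x : ℝ × ℝ => fderiv ℝ f (x.1 * e x.2) (I * e x.2))
      (Ioi 0 ×ˢ Ioo (-Real.pi) Real.pi) :=
    integrableOn_polar (F := fun z w => fderiv ℝ f z (I * w))
      ((hcd.comp continuous_fst).clm_apply (continuous_const.mul continuous_snd)) (R := R)
      fun z w hz => by simp [hR z hz]
  rw [← Complex.integral_comp_polarCoord_symm, polarCoord_target]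
  -- In polar coordinates the Jacobian `r` cancels the singularity of `t⁻¹`, and `∂̄` splits into a
  -- radial and an angular derivative. The radial part integrates to `-f 0` for each angle, the
  -- angular part to `0` for each radius.
  have h1 : ∫ x in Ioi (0 : ℝ) ×ˢ Ioo (-Real.pi) Real.pi,
      x.1 • (dbar f (Complex.polarCoord.symm x) * (Complex.polarCoord.symm x)⁻¹) =
      ∫ x in Ioi (0 : ℝ) ×ˢ Ioo (-Real.pi) Real.pi, (1 / 2 : ℂ) *
        (fderiv ℝ f (x.1 * e x.2) (e x.2) + I * fderiv ℝ f (x.1 * e x.2) (I * e x.2)) := by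
    refine setIntegral_congr_fun (measurableSet_Ioi.prod measurableSet_Ioo) ?_
    rintro ⟨r, θ⟩ ⟨hr, -⟩
    have hr' : (r : ℂ) ≠ 0 := by exact_mod_cast (ne_of_gt hr : r ≠ 0)
    have hsum : ∀ (L : ℂ →L[ℝ] ℂ) (a b : ℝ), L (a + b * I) = a * L 1 + b * L I := fun L a b => by
      have : (a + b * I : ℂ) = a • (1 : ℂ) + b • I := by simp
      rw [this, map_add, map_smul, map_smul, real_smul, real_smul]
    have e1 : e θ = Real.cos θ + Real.sin θ * I := rfl
    have e2 : I * e θ = (-Real.sin θ : ℝ) + Real.cos θ * I := by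
      rw [e1]; push_cast; linear_combination Complex.sin θ * I_sq
    have hne : e θ ≠ 0 := fun h => by simpa [h] using he θ
    have hinv : (e θ)⁻¹ = Real.cos θ - Real.sin θ * I := by
      refine inv_eq_of_mul_eq_one_right ?_
      rw [e1]
      push_cast
      linear_combination Complex.sin_sq_add_cos_sq (θ : ℂ) - (Complex.sin θ) ^ 2 * I_sq
    simp only [Complex.polarCoord_symm_apply, real_smul]
    change (r : ℂ) * (dbar f (r * e θ) * (r * e θ)⁻¹) = 1 / 2 *
      (fderiv ℝ f (r * e θ) (e θ) + I * fderiv ℝ f (r * e θ) (I * e θ))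
    generalize hL : fderiv ℝ f (r * e θ) = L
    rw [e2, hsum, hsum, dbar, hL, mul_inv, hinv]
    field_simp
    push_cast
    linear_combination (- Complex.sin θ * L I) * I_sq
  rw [h1, integral_const_mul, integral_add hA (hB.const_mul I), integral_const_mul]
  have hA' : ∫ x in Ioi (0 : ℝ) ×ˢ Ioo (-Real.pi) Real.pi, fderiv ℝ f (x.1 * e x.2) (e x.2) =
      -(2 * Real.pi) * f 0 := by
    rw [Measure.volume_eq_prod] at hA ⊢
    rw [IntegrableOn, ← Measure.prod_restrict] at hA
    rw [← Measure.prod_restrict, integral_prod_symm _ hA]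
    simp only [integral_radial_deriv hf hc _ (he _)]
    rw [setIntegral_const, Measure.real, Real.volume_Ioo,
      ENNReal.toReal_ofReal (by linarith [Real.pi_pos]), real_smul]
    push_cast
    ring
  have hB' : ∫ x in Ioi (0 : ℝ) ×ˢ Ioo (-Real.pi) Real.pi,
      fderiv ℝ f (x.1 * e x.2) (I * e x.2) = 0 := by
    rw [Measure.volume_eq_prod] at hB ⊢
    rw [setIntegral_prod _ hB]
    refine setIntegral_eq_zero_of_forall_eq_zero fun r hr => ?_
    exact integral_circular_deriv hf r hr
  rw [hA', hB']
  ring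

theorem cauchyTransform_eq_convolution (g : ℂ → ℂ) :
    cauchyTransform g = fun z => (Real.pi : ℂ)⁻¹ *
      (convolution g (fun z : ℂ => z⁻¹) (ContinuousLinearMap.mul ℝ ℂ) volume) z := rfl

theorem integrable_mul_inv_sub {g : ℂ → ℂ} (hg : Continuous g) (hc : HasCompactSupport g) (z : ℂ) :
    Integrable fun t => g t * (z - t)⁻¹ :=
  hc.convolutionExists_left (ContinuousLinearMap.mul ℝ ℂ) hg locallyIntegrable_inv z

theorem dbar_eq_half_smul {f : ℂ → ℂ} {L : ℂ →L[ℝ] ℂ} {z : ℂ} (h : HasFDerivAt f L z) :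
    dbar f z = (L 1 + I * L I) / 2 := by
  rw [dbar, h.fderiv]

theorem contDiff_cauchyTransform {n : ℕ∞} {g : ℂ → ℂ} (hg : ContDiff ℝ n g)
    (hc : HasCompactSupport g) : ContDiff ℝ n (cauchyTransform g) := by
  rw [cauchyTransform_eq_convolution]
  exact contDiff_const.mul (hc.contDiff_convolution_left _ hg locallyIntegrable_inv)

/-- In the convolution the derivative may be moved onto `g`; after translation to `z` the claim is
the Cauchy–Pompeiu formula at the origin. -/
theorem dbar_cauchyTransform {g : ℂ → ℂ} (hg : ContDiff ℝ 1 g) (hc : HasCompactSupport g)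
    (z : ℂ) : dbar (cauchyTransform g) z = g z := by
  have h := (hc.hasFDerivAt_convolution_left (ContinuousLinearMap.mul ℝ ℂ) hg
    locallyIntegrable_inv z).const_mul (Real.pi : ℂ)⁻¹
  have hcd := hg.continuous_fderiv one_ne_zero
  have hv : ∀ v : ℂ, (convolution (fderiv ℝ g) (fun z : ℂ => z⁻¹)
      ((ContinuousLinearMap.mul ℝ ℂ).precompL ℂ) volume z) v =
      ∫ t, fderiv ℝ g t v * (z - t)⁻¹ := fun v =>
    ContinuousLinearMap.integral_apply ((hc.fderiv ℝ).convolutionExists_left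
      ((ContinuousLinearMap.mul ℝ ℂ).precompL ℂ) hcd locallyIntegrable_inv z) v
  have hi : ∀ v : ℂ, Integrable fun t => fderiv ℝ g t v * (z - t)⁻¹ := fun v =>
    integrable_mul_inv_sub (hcd.clm_apply continuous_const)
      ((hc.fderiv ℝ).comp_left (g := fun L : ℂ →L[ℝ] ℂ => L v) (by simp)) z
  have h' : dbar (cauchyTransform g) z = _ := dbar_eq_half_smul h
  rw [h']
  simp only [_root_.smul_apply, hv, smul_eq_mul]
  have e1 : ((Real.pi : ℂ)⁻¹ * ∫ t, fderiv ℝ g t 1 * (z - t)⁻¹) +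
      I * ((Real.pi : ℂ)⁻¹ * ∫ t, fderiv ℝ g t I * (z - t)⁻¹) =
      2 * (Real.pi : ℂ)⁻¹ * ∫ t, dbar g t * (z - t)⁻¹ := by
    have : ∀ t, dbar g t * (z - t)⁻¹ = (1 / 2) * (fderiv ℝ g t 1 * (z - t)⁻¹ +
      I * (fderiv ℝ g t I * (z - t)⁻¹)) := fun t => by rw [dbar]; ring
    simp_rw [this]
    rw [integral_const_mul, integral_add (hi 1) ((hi I).const_mul I), integral_const_mul]
    ring
  rw [e1]
  have e2 : ∫ t, dbar g t * (z - t)⁻¹ = -∫ t, dbar (fun s => g (z + s)) t * t⁻¹ := by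
    rw [← integral_add_left_eq_self _ z, ← integral_neg]
    refine integral_congr_ae (Eventually.of_forall fun t => ?_)
    simp only [dbar, fderiv_comp_add_left, sub_add_cancel_left, inv_neg, mul_neg]
  rw [e2, integral_dbar_mul_inv]
  · have : (Real.pi : ℂ) ≠ 0 := by exact_mod_cast Real.pi_ne_zero
    field_simp
    simp
  · exact hg.comp (contDiff_const.add contDiff_id)
  · exact hc.comp_homeomorph (Homeomorph.addLeft z)

theorem cauchyTransform_add {g h : ℂ → ℂ} (hg : Continuous g) (hgc : HasCompactSupport g)
    (hh : Continuous h) (hhc : HasCompactSupport h) (z : ℂ) :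
    cauchyTransform (fun t => g t + h t) z = cauchyTransform g z + cauchyTransform h z := by
  simp only [cauchyTransform, add_mul]
  rw [integral_add (integrable_mul_inv_sub hg hgc z) (integrable_mul_inv_sub hh hhc z), mul_add]

theorem cauchyTransform_const_mul (c : ℂ) (g : ℂ → ℂ) (z : ℂ) :
    cauchyTransform (fun t => c * g t) z = c * cauchyTransform g z := by
  simp only [cauchyTransform, mul_assoc]
  rw [integral_const_mul]
  ring

theorem norm_cauchyTransform_le {K : Set ℂ} (hK : IsCompact K) {g : ℂ → ℂ} {B δ : ℝ}
    (hδ : 0 < δ) (hB : ∀ t, ‖g t‖ ≤ B) (hg : ∀ t ∉ K, g t = 0) {z : ℂ}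
    (hz : ∀ t ∈ K, δ ≤ ‖z - t‖) :
    ‖cauchyTransform g z‖ ≤ Real.pi⁻¹ * (B * δ⁻¹ * volume.real K) := by
  rw [cauchyTransform, norm_mul, norm_inv, norm_real, Real.norm_of_nonneg Real.pi_pos.le]
  gcongr
  rw [← setIntegral_eq_integral_of_forall_compl_eq_zero (s := K)
    (fun t ht => by rw [hg t ht, zero_mul])]
  refine norm_setIntegral_le_of_norm_le_const hK.measure_lt_top fun t ht => ?_
  rw [norm_mul, norm_inv]
  have hB0 := (norm_nonneg _).trans (hB t)
  gcongr
  · exact hB t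
  · exact hz t ht

/-- The difference of the two kernels is `(z' - z) / ((z - t)(z' - t))`. The bound is linear in `B`,
which makes the family of transforms equicontinuous away from `K`, uniformly on bounded sets of `g`.
-/
theorem norm_cauchyTransform_sub_le {K : Set ℂ} (hK : IsCompact K) {g : ℂ → ℂ}
    (hgc : Continuous g) {B δ : ℝ}
    (hδ : 0 < δ) (hB : ∀ t, ‖g t‖ ≤ B) (hg : ∀ t ∉ K, g t = 0) {z z' : ℂ}
    (hz : ∀ t ∈ K, δ ≤ ‖z - t‖) (hz' : ∀ t ∈ K, δ ≤ ‖z' - t‖) :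
    ‖cauchyTransform g z - cauchyTransform g z'‖ ≤
      Real.pi⁻¹ * (B * (‖z - z'‖ * (δ⁻¹ * δ⁻¹)) * volume.real K) := by
  have hgs : HasCompactSupport g := HasCompactSupport.intro hK hg
  rw [cauchyTransform, cauchyTransform, ← mul_sub, ← integral_sub
    (integrable_mul_inv_sub hgc hgs z) (integrable_mul_inv_sub hgc hgs z'), norm_mul, norm_inv,
    norm_real, Real.norm_of_nonneg Real.pi_pos.le]
  gcongr
  rw [← setIntegral_eq_integral_of_forall_compl_eq_zero (s := K)
    (fun t ht => by rw [hg t ht, zero_mul, zero_mul, sub_zero])]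
  refine norm_setIntegral_le_of_norm_le_const hK.measure_lt_top fun t ht => ?_
  have h1 : z - t ≠ 0 := norm_pos_iff.1 (hδ.trans_le (hz t ht))
  have h2 : z' - t ≠ 0 := norm_pos_iff.1 (hδ.trans_le (hz' t ht))
  have h3 : g t * (z - t)⁻¹ - g t * (z' - t)⁻¹ =
      g t * ((z' - z) * ((z - t)⁻¹ * (z' - t)⁻¹)) := by
    field_simp
    ring
  have hB0 := (norm_nonneg _).trans (hB t)
  rw [h3, norm_mul, norm_mul, norm_mul, norm_inv, norm_inv, norm_sub_rev z' z]
  gcongr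
  · exact hB t
  · exact hz t ht
  · exact hz' t ht

theorem exists_forall_le_norm_sub {K : Set ℂ} (hK : IsCompact K) {z : ℂ} (hz : z ∉ K) :
    ∃ δ > 0, ∀ w ∈ Metric.ball z δ, ∀ t ∈ K, δ ≤ ‖w - t‖ := by
  obtain ⟨ε, hε, h⟩ := Metric.isOpen_iff.1 hK.isClosed.isOpen_compl z hz
  refine ⟨ε / 2, half_pos hε, fun w hw t ht => ?_⟩
  by_contra hlt
  rw [not_le, ← dist_eq_norm] at hlt
  refine h (?_ : t ∈ Metric.ball z ε) ht
  rw [Metric.mem_ball] at hw ⊢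
  calc dist t z ≤ dist t w + dist w z := dist_triangle _ _ _
    _ < ε / 2 + ε / 2 := add_lt_add (by rwa [dist_comm]) hw
    _ = ε := add_halves ε

/-- Off the support the kernel is holomorphic in `z` and dominated, so one differentiates under the
integral. Continuity of `g` is enough, which is what later makes the parametrix error smoothing. -/
theorem differentiableAt_cauchyTransform {K : Set ℂ} (hK : IsCompact K) {g : ℂ → ℂ}
    (hgc : Continuous g) (hg : ∀ t ∉ K, g t = 0) {z : ℂ} (hz : z ∉ K) :
    DifferentiableAt ℂ (cauchyTransform g) z := by
  have hgs : HasCompactSupport g := HasCompactSupport.intro hK hg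
  obtain ⟨δ, hδ, h⟩ := exists_forall_le_norm_sub hK hz
  have := hasDerivAt_integral_of_dominated_loc_of_deriv_le (μ := volume) (𝕜 := ℂ)
    (F := fun z t => g t * (z - t)⁻¹) (F' := fun z t => g t * (-1 / (z - t) ^ 2))
    (x₀ := z) (bound := fun t => ‖g t‖ * (1 / δ ^ 2)) (Metric.ball_mem_nhds z hδ)
    (Eventually.of_forall fun w => (integrable_mul_inv_sub hgc hgs w).aestronglyMeasurable)
    (integrable_mul_inv_sub hgc hgs z)
    (hgc.aestronglyMeasurable.mul (by
      exact (measurable_const.div ((measurable_const.sub measurable_id).pow_const 2)).aestronglyMeasurable))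
    (Eventually.of_forall fun t w hw => ?_)
    ((hgc.norm.integrable_of_hasCompactSupport hgs.norm).mul_const _)
    (Eventually.of_forall fun t w hw => ?_)
  · exact (this.2.const_mul _).differentiableAt
  · by_cases ht : t ∈ K
    · rw [norm_mul, norm_div, norm_neg, norm_one, norm_pow]
      gcongr
      exact h w hw t ht
    · simp [hg t ht]
  · by_cases ht : t ∈ K
    · have h1 : w - t ≠ 0 := norm_pos_iff.1 (hδ.trans_le (h w hw t ht))
      have h2 : HasDerivAt (fun w : ℂ => w - t) 1 w := (hasDerivAt_id w).sub_const t
      exact (h2.fun_inv h1).const_mul (g t)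
    · simpa [hg t ht] using hasDerivAt_const w (0 : ℂ)

end CauchyTransform

/-! ### Finite dimensional obstructions and linear algebra. -/

section Fredholm

/-- Neumann series: `1 + S` is invertible because `‖S‖ < 1`. -/
theorem exists_add_eq_of_norm_le_half {E : Type*} [NormedAddCommGroup E] [NormedSpace ℂ E]
    [CompleteSpace E] (S : E →ₗ[ℂ] E) (hS : ∀ g, ‖S g‖ ≤ 1 / 2 * ‖g‖) :
    ∃ Q : E →ₗ[ℂ] E, ∀ h, Q h + S (Q h) = h := by
  let S' : E →L[ℂ] E := S.mkContinuous (1 / 2) hS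
  have hn : ‖-S'‖ < 1 := by
    rw [norm_neg]
    exact (S.mkContinuous_norm_le (by norm_num) hS).trans_lt (by norm_num)
  let U := Units.oneSub (-S') hn
  refine ⟨((U⁻¹ : (E →L[ℂ] E)ˣ) : E →L[ℂ] E).toLinearMap, fun h => ?_⟩
  have h1 : ((U : E →L[ℂ] E) * ((U⁻¹ : (E →L[ℂ] E)ˣ) : E →L[ℂ] E)) h = h := by
    rw [Units.mul_inv]; rfl
  have h2 : ∀ y, (U : E →L[ℂ] E) y = y + S y := fun y => by
    change (1 - -S') y = _
    simp [S']
  rw [← h2]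
  exact h1

/-- If a linear operator on a space of continuous functions sends bounded sets to equicontinuous
sets, then the range of `1 + T` contains the kernel of a linear map to a finite dimensional
space. -/
theorem exists_ker_le_range_one_add {X ι : Type*} [TopologicalSpace X] [CompactSpace X] [T2Space X]
    [Fintype ι] (T : C(X, ι → ℂ) →ₗ[ℂ] C(X, ι → ℂ))
    (hT : ∀ x, ∀ ε > 0, ∀ᶠ y in 𝓝 x, ∀ g, ‖T g y - T g x‖ ≤ ε * ‖g‖) :
    ∃ (s : Finset X) (Λ : C(X, ι → ℂ) →ₗ[ℂ] (s → ι → ℂ)),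
      ∀ h, Λ h = 0 → ∃ g, g + T g = h := by
  have hT' : ∀ x, ∃ U : Set X, IsOpen U ∧ x ∈ U ∧ ∀ y ∈ U, ∀ g, ‖T g y - T g x‖ ≤ 1 / 2 * ‖g‖ :=
    fun x => by
      obtain ⟨U, h1, h2, h3⟩ := eventually_nhds_iff.1 (hT x (1 / 2) (by norm_num))
      exact ⟨U, h2, h3, h1⟩
  choose U hUo hxU hU using hT'
  obtain ⟨s, hs⟩ := isCompact_univ.elim_finite_subcover U hUo
    fun x _ => Set.mem_iUnion.2 ⟨x, hxU x⟩
  obtain ⟨ρ, hρ⟩ := PartitionOfUnity.exists_isSubordinate (ι := s) isClosed_univ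
    (fun a => U a) (fun a => hUo a) (by simpa [Set.iUnion_subtype] using hs)
  have hsum : ∀ x, ∑ a, ρ a x = 1 := fun x => by
    rw [← finsum_eq_sum_of_fintype]; exact ρ.sum_eq_one (Set.mem_univ x)
  let ev : C(X, ι → ℂ) →ₗ[ℂ] (s → ι → ℂ) :=
    { toFun := fun g a => T g a
      map_add' := fun g h => by ext; simp
      map_smul' := fun c g => by ext; simp }
  -- `TF g` interpolates `T g` from its values at the finitely many points of `s` by the partition
  -- of unity. By equicontinuity it approximates `T` within `1/2` in operator norm.
  let TF : C(X, ι → ℂ) →ₗ[ℂ] C(X, ι → ℂ) :=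
    { toFun := fun g => ⟨fun x => ∑ a, ρ a x • ev g a, by fun_prop⟩
      map_add' := fun g h => ContinuousMap.ext fun x => by
        change ∑ a, ρ a x • ev (g + h) a = ∑ a, ρ a x • ev g a + ∑ a, ρ a x • ev h a
        simp only [map_add, Pi.add_apply, smul_add, Finset.sum_add_distrib]
      map_smul' := fun c g => ContinuousMap.ext fun x => by
        change ∑ a, ρ a x • ev (c • g) a = c • ∑ a, ρ a x • ev g a
        rw [map_smul, Finset.smul_sum]
        exact Finset.sum_congr rfl fun a _ => (smul_comm (ρ a x) c (ev g a) :) }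
  obtain ⟨Q, hQ⟩ := exists_add_eq_of_norm_le_half (T - TF) (fun g => by
    rw [ContinuousMap.norm_le _ (by positivity)]
    intro x
    have h1 : (T - TF) g x = ∑ a, ρ a x • (T g x - T g a) := by
      simp only [smul_sub, Finset.sum_sub_distrib, ← Finset.sum_smul, hsum, one_smul]
      rfl
    rw [h1]
    calc ‖∑ a, ρ a x • (T g x - T g a)‖ ≤ ∑ a, ρ a x * (1 / 2 * ‖g‖) := by
          refine norm_sum_le_of_le _ fun a _ => ?_
          rw [norm_smul, Real.norm_of_nonneg (ρ.nonneg a x)]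
          by_cases hx : ρ a x = 0
          · simp [hx]
          · exact mul_le_mul_of_nonneg_left (hU a x (hρ a (subset_tsupport _ hx)) g)
              (ρ.nonneg a x)
      _ = 1 / 2 * ‖g‖ := by rw [← Finset.sum_mul, hsum, one_mul])
  -- `Q` is a right inverse of `1 + T - TF`. When the samples of `T (Q h)` vanish, so does `TF (Q
  -- h)`, and `Q h` solves the original equation.
  refine ⟨s, ev ∘ₗ Q, fun h hh => ⟨Q h, ?_⟩⟩
  have h2 : TF (Q h) = 0 := by
    have h3 : ev (Q h) = 0 := hh
    refine ContinuousMap.ext fun x => ?_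
    change ∑ a, ρ a x • ev (Q h) a = 0
    simp only [h3, Pi.zero_apply, smul_zero, Finset.sum_const_zero]
  have := hQ h
  rwa [LinearMap.sub_apply, h2, sub_zero] at this

/-- A set of indices that contains the leading index of no linear relation between vectors of a
finite dimensional space is finite. -/
theorem finite_of_forall_linearCombination_ne_zero {V : Type*} [AddCommGroup V] [Module ℂ V]
    [FiniteDimensional ℂ V] (w : ℕ → V) (G : Set ℕ)
    (hG : ∀ c : ℕ →₀ ℂ, c ≠ 0 → (∀ n ∈ c.support, n ∈ G) →
      Finsupp.linearCombination ℂ w c ≠ 0) : G.Finite := by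
  have hli : LinearIndepOn ℂ w G := by
    rw [linearIndepOn_iff]
    intro c hc h0
    by_contra hne
    exact hG c hne (fun n hn => (Finsupp.mem_supported ℂ c).1 hc hn) h0
  exact Set.finite_coe_iff.1 hli.linearIndependent.finite

end Fredholm

/-! ### Real smooth functions on a Riemann surface and `∂̄` in charts. -/

section RealStructure

open Set Filter

set_option linter.unusedSectionVars false

variable {C : Type u} [TopologicalSpace C] [ChartedSpace ℂ C]

/-- Complex analytic coordinate changes are real smooth. The surface thereby becomes a real
manifold, on which smooth partitions of unity exist. -/
theorem contDiffGroupoid_complex_le_real :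
    contDiffGroupoid ω 𝓘(ℂ) ≤ contDiffGroupoid ∞ 𝓘(ℝ, ℂ) := by
  intro e he
  change e ∈ (contDiffPregroupoid ω 𝓘(ℂ)).groupoid at he
  change e ∈ (contDiffPregroupoid ∞ 𝓘(ℝ, ℂ)).groupoid
  rw [mem_groupoid_of_pregroupoid] at he ⊢
  refine ⟨?_, ?_⟩
  · exact (ContDiffOn.restrict_scalars (𝕜 := ℝ) he.1).of_le le_top
  · exact (ContDiffOn.restrict_scalars (𝕜 := ℝ) he.2).of_le le_top

instance isManifold_real [IsManifold 𝓘(ℂ) ω C] : IsManifold 𝓘(ℝ, ℂ) ∞ C where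
  compatible he he' := contDiffGroupoid_complex_le_real
    (StructureGroupoid.compatible (contDiffGroupoid ω 𝓘(ℂ)) he he')

theorem mem_maximalAtlas_real {φ : OpenPartialHomeomorph C ℂ}
    (hφ : φ ∈ IsManifold.maximalAtlas 𝓘(ℂ) ω C) : φ ∈ IsManifold.maximalAtlas 𝓘(ℝ, ℂ) ∞ C :=
  StructureGroupoid.maximalAtlas_mono contDiffGroupoid_complex_le_real hφ

/-- A complex valued function on a Riemann surface is smooth (in the real sense) at a point. -/
abbrev SmoothAt (f : C → ℂ) (x : C) : Prop := ContMDiffAt 𝓘(ℝ, ℂ) 𝓘(ℝ, ℂ) ∞ f x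

variable {φ φ' : OpenPartialHomeomorph C ℂ}

theorem SmoothAt.contDiffAt_chart (hφ : φ ∈ IsManifold.maximalAtlas 𝓘(ℂ) ω C) {f : C → ℂ} {x : C}
    (hx : x ∈ φ.source) (hf : SmoothAt f x) : ContDiffAt ℝ ∞ (f ∘ φ.symm) (φ x) := by
  rw [← contMDiffAt_iff_contDiffAt]
  refine ContMDiffAt.comp (φ x) (by rwa [φ.left_inv hx]) ?_
  exact contMDiffAt_symm_of_mem_maximalAtlas (mem_maximalAtlas_real hφ) (φ.map_source hx)

theorem SmoothAt.of_chart (hφ : φ ∈ IsManifold.maximalAtlas 𝓘(ℂ) ω C) {v : ℂ → ℂ} {x : C}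
    (hx : x ∈ φ.source) (hv : ContDiffAt ℝ ∞ v (φ x)) : SmoothAt (v ∘ φ) x :=
  ContMDiffAt.comp x hv.contMDiffAt
    (contMDiffAt_of_mem_maximalAtlas (mem_maximalAtlas_real hφ) hx)

theorem contDiffAt_dbar {f : ℂ → ℂ} {z : ℂ} (hf : ContDiffAt ℝ ∞ f z) :
    ContDiffAt ℝ ∞ (dbar f) z := by
  have h : ContDiffAt ℝ ∞ (fderiv ℝ f) z := hf.fderiv_right (by simp)
  exact ((h.clm_apply contDiffAt_const).add
    (contDiffAt_const.mul (h.clm_apply contDiffAt_const))).div_const 2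

theorem SmoothAt.mul' {f g : C → ℂ} {x : C} (hf : SmoothAt f x) (hg : SmoothAt g x) :
    SmoothAt (fun y => f y * g y) x :=
  (contDiff_mul (𝕜 := ℝ) (𝔸 := ℂ)).contMDiff.contMDiffAt.comp x (hf.prodMk_space hg)

theorem SmoothAt.add' {f g : C → ℂ} {x : C} (hf : SmoothAt f x) (hg : SmoothAt g x) :
    SmoothAt (fun y => f y + g y) x :=
  (contDiff_add (𝕜 := ℝ) (F := ℂ)).contMDiff.contMDiffAt.comp x (hf.prodMk_space hg)

theorem SmoothAt.const_mul {f : C → ℂ} {x : C} (c : ℂ) (hf : SmoothAt f x) :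
    SmoothAt (fun y => c * f y) x :=
  SmoothAt.mul' contMDiffAt_const hf

theorem SmoothAt.sub' {f g : C → ℂ} {x : C} (hf : SmoothAt f x) (hg : SmoothAt g x) :
    SmoothAt (fun y => f y - g y) x := by
  simpa [sub_eq_add_neg] using hf.add' (hg.const_mul (-1))

theorem SmoothAt.sum {ι : Type*} (s : Finset ι) {f : ι → C → ℂ} {x : C}
    (hf : ∀ i ∈ s, SmoothAt (f i) x) : SmoothAt (fun y => ∑ i ∈ s, f i y) x := by
  classical
  induction s using Finset.induction_on with
  | empty => simpa using contMDiffAt_const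
  | insert i s hi ih =>
    simp only [Finset.sum_insert hi]
    exact (hf i (Finset.mem_insert_self i s)).add'
      (ih fun j hj => hf j (Finset.mem_insert_of_mem hj))

theorem dbar_congr {f g : ℂ → ℂ} {z : ℂ} (h : f =ᶠ[𝓝 z] g) : dbar f z = dbar g z := by
  rw [dbar, dbar, h.fderiv_eq]

theorem dbar_mul {f g : ℂ → ℂ} {z : ℂ} (hf : DifferentiableAt ℝ f z) (hg : DifferentiableAt ℝ g z) :
    dbar (fun w => f w * g w) z = dbar f z * g z + f z * dbar g z := by
  rw [dbar, fderiv_fun_mul hf hg, dbar, dbar]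
  simp
  ring

theorem dbar_sum {ι : Type*} (s : Finset ι) {f : ι → ℂ → ℂ} {z : ℂ}
    (hf : ∀ i ∈ s, DifferentiableAt ℝ (f i) z) :
    dbar (fun w => ∑ i ∈ s, f i w) z = ∑ i ∈ s, dbar (f i) z := by
  rw [dbar, fderiv_fun_sum hf]
  simp only [dbar, _root_.sum_apply, Finset.mul_sum, ← Finset.sum_add_distrib, Finset.sum_div]

theorem dbar_const_mul (c : ℂ) {f : ℂ → ℂ} {z : ℂ} (hf : DifferentiableAt ℝ f z) :
    dbar (fun w => c * f w) z = c * dbar f z := by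
  rw [dbar, fderiv_const_mul hf, dbar]
  simp
  ring

theorem dbar_sub {f g : ℂ → ℂ} {z : ℂ} (hf : DifferentiableAt ℝ f z) (hg : DifferentiableAt ℝ g z) :
    dbar (fun w => f w - g w) z = dbar f z - dbar g z := by
  rw [dbar, fderiv_fun_sub hf hg, dbar, dbar]
  simp
  ring

/-- This is the Cauchy–Riemann equation. -/
theorem dbar_eq_zero_iff {f : ℂ → ℂ} {z : ℂ} (hf : DifferentiableAt ℝ f z) :
    dbar f z = 0 ↔ DifferentiableAt ℂ f z := by
  rw [differentiableAt_complex_iff_differentiableAt_real, dbar, div_eq_zero_iff,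
    or_iff_left two_ne_zero, and_iff_right hf, smul_eq_mul]
  constructor <;> intro h
  · linear_combination -Complex.I * h + fderiv ℝ f z Complex.I * Complex.I_sq
  · linear_combination Complex.I * h + fderiv ℝ f z 1 * Complex.I_sq

/-- The differential of a holomorphic `τ` is multiplication by `τ'`, so only its conjugate enters
the antilinear part. This is the transformation law of the coefficient of `dz̄`. -/
theorem dbar_comp {f τ : ℂ → ℂ} {z : ℂ} (hf : DifferentiableAt ℝ f (τ z))
    (hτ : DifferentiableAt ℂ τ z) :
    dbar (f ∘ τ) z = dbar f (τ z) * (starRingEnd ℂ) (deriv τ z) := by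
  have h1 : HasFDerivAt τ ((fderiv ℂ τ z).restrictScalars ℝ) z :=
    hτ.hasFDerivAt.restrictScalars ℝ
  rw [dbar_eq_half_smul (hf.hasFDerivAt.comp z h1), dbar]
  have h2 : ∀ v, fderiv ℂ τ z v = v * deriv τ z := fun v => by
    rw [← fderiv_apply_one_eq_deriv, ← smul_eq_mul, ← map_smul, smul_eq_mul, mul_one]
  generalize fderiv ℝ f (τ z) = D
  have h3 : ∀ w : ℂ, D w = w.re * D 1 + w.im * D Complex.I := fun w => by
    conv_lhs => rw [← Complex.re_add_im w]
    have : (w.re + w.im * Complex.I : ℂ) = w.re • (1 : ℂ) + w.im • Complex.I := by simp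
    rw [this, map_add, map_smul, map_smul, Complex.real_smul, Complex.real_smul]
  simp only [ContinuousLinearMap.comp_apply, ContinuousLinearMap.coe_restrictScalars', h2]
  generalize deriv τ z = a
  rw [h3 (1 * a), h3 (Complex.I * a)]
  have h4 : (starRingEnd ℂ) a = a.re - a.im * Complex.I := by
    apply Complex.ext <;> simp
  rw [h4]
  simp
  linear_combination (a.im * D Complex.I / 2) * Complex.I_sq

/-- The Wirtinger derivative of a function on a Riemann surface with respect to a chart. -/
def chartDbar (φ : OpenPartialHomeomorph C ℂ) (f : C → ℂ) (x : C) : ℂ := dbar (f ∘ φ.symm) (φ x)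

/-- The derivative of the coordinate change from `φ'` to `φ` at the point `x`. -/
def chartJac (φ φ' : OpenPartialHomeomorph C ℂ) (x : C) : ℂ := deriv (φ ∘ φ'.symm) (φ' x)

theorem SmoothAt.chartDbar (hφ : φ ∈ IsManifold.maximalAtlas 𝓘(ℂ) ω C) {f : C → ℂ} {x : C}
    (hx : x ∈ φ.source) (hf : SmoothAt f x) : SmoothAt (chartDbar φ f) x :=
  SmoothAt.of_chart hφ hx (contDiffAt_dbar (hf.contDiffAt_chart hφ hx))

theorem chartDbar_congr {f g : C → ℂ} {x : C} (hx : x ∈ φ.source) (h : f =ᶠ[𝓝 x] g) :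
    chartDbar φ f x = chartDbar φ g x := by
  refine dbar_congr ?_
  have := φ.continuousAt_symm (φ.map_source hx)
  rw [ContinuousAt, φ.left_inv hx] at this
  exact this.eventually h

theorem chartDbar_const (φ : OpenPartialHomeomorph C ℂ) (c : ℂ) (x : C) :
    chartDbar φ (fun _ => c) x = 0 := by
  change dbar (fun _ => c) (φ x) = 0
  simp [dbar]

theorem SmoothAt.differentiableAt_chart (hφ : φ ∈ IsManifold.maximalAtlas 𝓘(ℂ) ω C) {f : C → ℂ}
    {x : C} (hx : x ∈ φ.source) (hf : SmoothAt f x) : DifferentiableAt ℝ (f ∘ φ.symm) (φ x) :=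
  (hf.contDiffAt_chart hφ hx).differentiableAt (by simp)

theorem chartDbar_mul (hφ : φ ∈ IsManifold.maximalAtlas 𝓘(ℂ) ω C) {f g : C → ℂ} {x : C}
    (hx : x ∈ φ.source) (hf : SmoothAt f x) (hg : SmoothAt g x) :
    chartDbar φ (fun y => f y * g y) x = chartDbar φ f x * g x + f x * chartDbar φ g x := by
  have := dbar_mul (hf.differentiableAt_chart hφ hx) (hg.differentiableAt_chart hφ hx)
  simpa [chartDbar, Function.comp_def, φ.left_inv hx] using this

theorem chartDbar_sub (hφ : φ ∈ IsManifold.maximalAtlas 𝓘(ℂ) ω C) {f g : C → ℂ} {x : C}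
    (hx : x ∈ φ.source) (hf : SmoothAt f x) (hg : SmoothAt g x) :
    chartDbar φ (fun y => f y - g y) x = chartDbar φ f x - chartDbar φ g x :=
  dbar_sub (hf.differentiableAt_chart hφ hx) (hg.differentiableAt_chart hφ hx)

theorem chartDbar_const_mul (hφ : φ ∈ IsManifold.maximalAtlas 𝓘(ℂ) ω C) (c : ℂ) {f : C → ℂ} {x : C}
    (hx : x ∈ φ.source) (hf : SmoothAt f x) :
    chartDbar φ (fun y => c * f y) x = c * chartDbar φ f x :=
  dbar_const_mul c (hf.differentiableAt_chart hφ hx)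

theorem chartDbar_sum (hφ : φ ∈ IsManifold.maximalAtlas 𝓘(ℂ) ω C) {ι : Type*} (s : Finset ι)
    {f : ι → C → ℂ} {x : C} (hx : x ∈ φ.source) (hf : ∀ i ∈ s, SmoothAt (f i) x) :
    chartDbar φ (fun y => ∑ i ∈ s, f i y) x = ∑ i ∈ s, chartDbar φ (f i) x :=
  dbar_sum s fun i hi => (hf i hi).differentiableAt_chart hφ hx

theorem differentiableAt_transition (hφ : φ ∈ IsManifold.maximalAtlas 𝓘(ℂ) ω C)
    (hφ' : φ' ∈ IsManifold.maximalAtlas 𝓘(ℂ) ω C) {x : C} (hx : x ∈ φ.source)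
    (hx' : x ∈ φ'.source) : DifferentiableAt ℂ (φ ∘ φ'.symm) (φ' x) := by
  have : ContMDiffAt 𝓘(ℂ) 𝓘(ℂ) ω (φ ∘ φ'.symm) (φ' x) := by
    refine ContMDiffAt.comp (φ' x) ?_
      (contMDiffAt_symm_of_mem_maximalAtlas hφ' (φ'.map_source hx'))
    rw [φ'.left_inv hx']
    exact contMDiffAt_of_mem_maximalAtlas hφ hx
  exact (contMDiffAt_iff_contDiffAt.1 this).differentiableAt (by simp)

theorem chartDbar_comp_chart (hφ : φ ∈ IsManifold.maximalAtlas 𝓘(ℂ) ω C)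
    (hφ' : φ' ∈ IsManifold.maximalAtlas 𝓘(ℂ) ω C) {v : ℂ → ℂ} {x : C} (hx : x ∈ φ.source)
    (hx' : x ∈ φ'.source) (hv : DifferentiableAt ℝ v (φ x)) :
    chartDbar φ' (v ∘ φ) x = dbar v (φ x) * (starRingEnd ℂ) (chartJac φ φ' x) := by
  have h1 : (φ ∘ φ'.symm) (φ' x) = φ x := by simp [φ'.left_inv hx']
  have := dbar_comp (f := v) (τ := φ ∘ φ'.symm) (z := φ' x) (by rwa [h1])
    (differentiableAt_transition hφ hφ' hx hx')
  rwa [h1] at this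

theorem chartDbar_change (hφ : φ ∈ IsManifold.maximalAtlas 𝓘(ℂ) ω C)
    (hφ' : φ' ∈ IsManifold.maximalAtlas 𝓘(ℂ) ω C) {f : C → ℂ} {x : C} (hx : x ∈ φ.source)
    (hx' : x ∈ φ'.source) (hf : SmoothAt f x) :
    chartDbar φ' f x = chartDbar φ f x * (starRingEnd ℂ) (chartJac φ φ' x) := by
  change _ = dbar (f ∘ φ.symm) (φ x) * _
  rw [← chartDbar_comp_chart hφ hφ' hx hx' (hf.differentiableAt_chart hφ hx)]
  refine chartDbar_congr hx' ?_
  filter_upwards [φ.open_source.mem_nhds hx] with y hy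
  simp [φ.left_inv hy]

/-- A smooth function with vanishing Wirtinger derivative is holomorphic. -/
theorem mdifferentiableAt_of_chartDbar_eq_zero (hφ : φ ∈ IsManifold.maximalAtlas 𝓘(ℂ) ω C)
    {f : C → ℂ} {x : C} (hx : x ∈ φ.source) (hf : SmoothAt f x) (h : chartDbar φ f x = 0) :
    MDifferentiableAt 𝓘(ℂ) 𝓘(ℂ) f x := by
  have h1 : DifferentiableAt ℂ (f ∘ φ.symm) (φ x) :=
    (dbar_eq_zero_iff (hf.differentiableAt_chart hφ hx)).1 h
  have h2 : MDifferentiableAt 𝓘(ℂ) 𝓘(ℂ) ((f ∘ φ.symm) ∘ φ) x :=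
    h1.mdifferentiableAt.comp x
      ((contMDiffAt_of_mem_maximalAtlas hφ hx).mdifferentiableAt (by simp))
  refine h2.congr_of_eventuallyEq ?_
  filter_upwards [φ.open_source.mem_nhds hx] with y hy
  simp [φ.left_inv hy]

theorem chartDbar_eq_zero_of_mdifferentiableAt (hφ : φ ∈ IsManifold.maximalAtlas 𝓘(ℂ) ω C)
    {f : C → ℂ} {x : C} (hx : x ∈ φ.source) (h : MDifferentiableAt 𝓘(ℂ) 𝓘(ℂ) f x) :
    chartDbar φ f x = 0 := by
  have h1 : MDifferentiableAt 𝓘(ℂ) 𝓘(ℂ) (f ∘ φ.symm) (φ x) := by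
    refine MDifferentiableAt.comp (φ x) (by rwa [φ.left_inv hx]) ?_
    exact (contMDiffAt_symm_of_mem_maximalAtlas hφ (φ.map_source hx)).mdifferentiableAt (by simp)
  have h2 := mdifferentiableAt_iff_differentiableAt.1 h1
  exact (dbar_eq_zero_iff (h2.restrictScalars ℝ)).2 h2

/-- Allows a factor `w` that is meaningful only on a chart domain: off the closed support of the
cutoff the product is locally zero. -/
theorem SmoothAt.mul_of_mem_tsupport {s w : C → ℂ} {x : C} (hs : SmoothAt s x)
    (hw : x ∈ tsupport s → SmoothAt w x) : SmoothAt (fun y => s y * w y) x := by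
  by_cases hx : x ∈ tsupport s
  · exact hs.mul' (hw hx)
  · refine (contMDiffAt_const (c := (0 : ℂ))).congr_of_eventuallyEq ?_
    filter_upwards [notMem_tsupport_iff_eventuallyEq.1 hx] with y hy
    simp [hy]

end RealStructure

/-! ### Charts with cutoff functions, and extension by zero to the plane. -/

section Cutoff

open Set Filter

set_option linter.unusedSectionVars false

variable {C : Type u} [TopologicalSpace C] [ChartedSpace ℂ C]

/-- A finite system of charts with a subordinate partition of unity `χ`, and cutoff functions `ψ`
that are `1` near the supports of the functions `χ`. -/
structure CutoffSystem (C : Type u) [TopologicalSpace C] [ChartedSpace ℂ C] (ι : Type u)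
    [Fintype ι] where
  φ : ι → OpenPartialHomeomorph C ℂ
  χ : ι → C → ℂ
  ψ : ι → C → ℂ
  mem_maximalAtlas : ∀ k, φ k ∈ IsManifold.maximalAtlas 𝓘(ℂ) ω C
  smooth_χ : ∀ k x, SmoothAt (χ k) x
  smooth_ψ : ∀ k x, SmoothAt (ψ k) x
  tsupport_χ : ∀ k, tsupport (χ k) ⊆ (φ k).source
  tsupport_ψ : ∀ k, tsupport (ψ k) ⊆ (φ k).source
  eventually_ψ : ∀ k, ∀ x ∈ tsupport (χ k), ∀ᶠ y in 𝓝 x, ψ k y = 1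
  sum_χ : ∀ x, ∑ k, χ k x = 1
  norm_χ_le : ∀ k x, ‖χ k x‖ ≤ 1

theorem exists_smooth_cutoff [T2Space C] [CompactSpace C] [IsManifold 𝓘(ℂ) ω C] {s t : Set C}
    (hs : IsClosed s) (ht : IsOpen t) (hst : s ⊆ t) :
    ∃ f : C → ℂ, (∀ x, SmoothAt f x) ∧ (∀ x ∈ s, ∀ᶠ y in 𝓝 x, f y = 1) ∧ tsupport f ⊆ t := by
  obtain ⟨v, hv, hsv, hvt⟩ := normal_exists_closure_subset hs ht hst
  obtain ⟨f, h1, h2, -⟩ := exists_contMDiffMap_one_nhds_of_subset_interior (n := ⊤) 𝓘(ℝ, ℂ) hs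
    (hsv.trans hv.interior_eq.ge)
  refine ⟨fun x => (f x : ℂ), fun x => ?_, fun x hx => ?_, ?_⟩
  · exact Complex.ofRealCLM.contDiff.contMDiff.contMDiffAt.comp x (f.contMDiff x)
  · filter_upwards [(mem_nhdsSet_iff_forall.1 h1) x hx] with y hy
    rw [hy, Complex.ofReal_one]
  · refine (closure_mono fun x hx => ?_).trans hvt
    by_contra hxv
    exact hx (by simp [h2 x hxv])

theorem exists_cutoffSystem [T2Space C] [CompactSpace C] [IsManifold 𝓘(ℂ) ω C] :
    ∃ (ι : Type u) (_ : Fintype ι), Nonempty (CutoffSystem C ι) := by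
  obtain ⟨s, hs⟩ := isCompact_univ.elim_finite_subcover (fun x : C => (chartAt ℂ x).source)
    (fun x => (chartAt ℂ x).open_source) fun x _ => mem_iUnion.2 ⟨x, mem_chart_source ℂ x⟩
  obtain ⟨ρ, hρ⟩ := SmoothPartitionOfUnity.exists_isSubordinate (ι := s) 𝓘(ℝ, ℂ)
    (isClosed_univ (X := C)) (fun a => (chartAt ℂ (a : C)).source)
    (fun a => (chartAt ℂ (a : C)).open_source) (by simpa [iUnion_subtype] using hs)
  have hts : ∀ k, tsupport (fun x => (ρ k x : ℂ)) ⊆ (chartAt ℂ (k : C)).source := fun k => by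
    refine (closure_mono fun x hx => ?_).trans (hρ k)
    exact fun h => hx (by simp [h])
  choose ψ h1 h2 h3 using fun k => exists_smooth_cutoff
    (isClosed_tsupport (fun x => (ρ k x : ℂ))) (chartAt ℂ (k : C)).open_source (hts k)
  refine ⟨s, inferInstance, ⟨⟨fun k => chartAt ℂ (k : C), fun k x => ρ k x, ψ,
    fun k => IsManifold.chart_mem_maximalAtlas _, fun k x => ?_, h1, hts, h3, h2, fun x => ?_,
    fun k x => ?_⟩⟩⟩
  · exact Complex.ofRealCLM.contDiff.contMDiff.contMDiffAt.comp x ((ρ k).contMDiff x)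
  · have := ρ.sum_eq_one (mem_univ x)
    rw [finsum_eq_sum_of_fintype] at this
    exact_mod_cast this
  · rw [Complex.norm_real, Real.norm_of_nonneg (ρ.nonneg k x)]
    exact ρ.le_one k x

/-- A function on a Riemann surface, as a function of the coordinate, extended by zero. -/
def chartExt (φ : OpenPartialHomeomorph C ℂ) (f : C → ℂ) : ℂ → ℂ :=
  φ.target.indicator (f ∘ φ.symm)

variable {φ : OpenPartialHomeomorph C ℂ} {f : C → ℂ}

theorem chartExt_apply {x : C} (hx : x ∈ φ.source) : chartExt φ f (φ x) = f x := by
  rw [chartExt, indicator_of_mem (φ.map_source hx)]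
  simp [φ.left_inv hx]

theorem chartExt_eq_zero {t : ℂ} (ht : t ∉ φ '' tsupport f) : chartExt φ f t = 0 := by
  by_cases h : t ∈ φ.target
  · rw [chartExt, indicator_of_mem h]
    exact image_eq_zero_of_notMem_tsupport (f := f) fun h' => ht ⟨_, h', φ.right_inv h⟩
  · rw [chartExt, indicator_of_notMem h]

theorem isCompact_image_chart [CompactSpace C] {K : Set C} (hK : IsClosed K)
    (hs : K ⊆ φ.source) : IsCompact (φ '' K) :=
  hK.isCompact.image_of_continuousOn (φ.continuousOn.mono hs)

/-- The image of the support is compact, hence closed in the plane. So the extension vanishes near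
every point outside the chart target, boundary points included. -/
theorem chartExt_mem_nhds_cases [CompactSpace C] (hs : tsupport f ⊆ φ.source) (t : ℂ) :
    (t ∈ φ.target ∧ chartExt φ f =ᶠ[𝓝 t] f ∘ φ.symm) ∨ chartExt φ f =ᶠ[𝓝 t] fun _ => 0 := by
  by_cases h : t ∈ φ.target
  · refine Or.inl ⟨h, ?_⟩
    filter_upwards [φ.open_target.mem_nhds h] with w hw
    rw [chartExt, indicator_of_mem hw]
  · right
    have h1 := isCompact_image_chart (φ := φ) (isClosed_tsupport f) hs
    have h2 : t ∉ φ '' tsupport f := by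
      rintro ⟨x, hx, rfl⟩
      exact h (φ.map_source (hs hx))
    filter_upwards [h1.isClosed.isOpen_compl.mem_nhds h2] with w hw
    exact chartExt_eq_zero hw

theorem continuous_chartExt [CompactSpace C] (hs : tsupport f ⊆ φ.source) (hf : Continuous f) :
    Continuous (chartExt φ f) := by
  rw [continuous_iff_continuousAt]
  intro t
  rcases chartExt_mem_nhds_cases hs t with ⟨h, h'⟩ | h'
  · exact (hf.continuousAt.comp (φ.continuousAt_symm h)).congr h'.symm
  · exact continuousAt_const.congr h'.symm

theorem contDiff_chartExt [CompactSpace C] (hφ : φ ∈ IsManifold.maximalAtlas 𝓘(ℂ) ω C)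
    (hs : tsupport f ⊆ φ.source) (hf : ∀ x, SmoothAt f x) : ContDiff ℝ ∞ (chartExt φ f) := by
  rw [contDiff_iff_contDiffAt]
  intro t
  rcases chartExt_mem_nhds_cases hs t with ⟨h, h'⟩ | h'
  · have := (hf (φ.symm t)).contDiffAt_chart hφ (φ.map_target h)
    rw [φ.right_inv h] at this
    exact this.congr_of_eventuallyEq h'
  · exact contDiffAt_const.congr_of_eventuallyEq h'

theorem norm_chartExt_le {B : ℝ} (hB : 0 ≤ B) (hf : ∀ x, ‖f x‖ ≤ B) (t : ℂ) :
    ‖chartExt φ f t‖ ≤ B := by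
  by_cases h : t ∈ φ.target
  · rw [chartExt, indicator_of_mem h]
    exact hf _
  · rwa [chartExt, indicator_of_notMem h, norm_zero]

end Cutoff

/-! ### The parametrix of `∂̄` on the compact surface and its compact error. -/

section Operator

open Set Filter

set_option linter.unusedSectionVars false

variable {C : Type u} [TopologicalSpace C] [ChartedSpace ℂ C] [CompactSpace C] [T2Space C]
  {ι : Type u} [Fintype ι] (S : CutoffSystem C ι)

namespace CutoffSystem

/-- The `j`-th component of a family of functions, cut off and transported to the plane. -/
def piece (j : ι) (g : C(C, ι → ℂ)) : ℂ → ℂ := chartExt (S.φ j) fun x => S.χ j x * g x j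

theorem tsupport_piece (j : ι) (g : C → ℂ) :
    tsupport (fun x => S.χ j x * g x) ⊆ tsupport (S.χ j) :=
  tsupport_mul_subset_left

theorem continuous_χ (j : ι) : Continuous (S.χ j) :=
  continuous_iff_continuousAt.2 fun x => (S.smooth_χ j x).continuousAt

theorem continuous_piece (j : ι) (g : C(C, ι → ℂ)) : Continuous (S.piece j g) :=
  continuous_chartExt ((S.tsupport_piece j _).trans (S.tsupport_χ j))
    ((S.continuous_χ j).mul (by fun_prop))

theorem piece_eq_zero (j : ι) (g : C(C, ι → ℂ)) (t : ℂ) (ht : t ∉ S.φ j '' tsupport (S.χ j)) :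
    S.piece j g t = 0 :=
  chartExt_eq_zero fun h => ht (image_mono (S.tsupport_piece j _) h)

theorem isCompact_supp (j : ι) : IsCompact (S.φ j '' tsupport (S.χ j)) :=
  isCompact_image_chart (isClosed_tsupport _) (S.tsupport_χ j)

theorem hasCompactSupport_piece (j : ι) (g : C(C, ι → ℂ)) : HasCompactSupport (S.piece j g) :=
  HasCompactSupport.intro (S.isCompact_supp j) (S.piece_eq_zero j g)

theorem norm_piece_le (j : ι) (g : C(C, ι → ℂ)) (t : ℂ) : ‖S.piece j g t‖ ≤ ‖g‖ := by
  refine norm_chartExt_le (norm_nonneg g) (fun x => ?_) t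
  rw [norm_mul]
  calc ‖S.χ j x‖ * ‖g x j‖ ≤ 1 * ‖g‖ := by
        gcongr
        · exact S.norm_χ_le j x
        · exact (norm_le_pi_norm _ j).trans (g.norm_coe_le_norm x)
    _ = ‖g‖ := one_mul _

theorem piece_add (j : ι) (g h : C(C, ι → ℂ)) :
    S.piece j (g + h) = fun t => S.piece j g t + S.piece j h t := by
  ext t
  by_cases ht : t ∈ (S.φ j).target <;> simp [piece, chartExt, ht, mul_add]

theorem piece_smul (j : ι) (c : ℂ) (g : C(C, ι → ℂ)) :
    S.piece j (c • g) = fun t => c * S.piece j g t := by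
  ext t
  by_cases ht : t ∈ (S.φ j).target <;> simp [piece, chartExt, ht, mul_left_comm]

/-- The coefficient functions of the parametrix error. -/
def coeff (k j : ι) (x : C) : ℂ := S.ψ k x * chartDbar (S.φ k) (S.ψ j) x

theorem smoothAt_coeff (k j : ι) (x : C) : SmoothAt (S.coeff k j) x :=
  (S.smooth_ψ k x).mul_of_mem_tsupport
    fun hx => (S.smooth_ψ j x).chartDbar (S.mem_maximalAtlas k) (S.tsupport_ψ k hx)

theorem coeff_eventually_eq_zero {k j : ι} {x : C} {c : ℂ} (h : ∀ᶠ y in 𝓝 x, S.ψ j y = c) :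
    ∀ᶠ y in 𝓝 x, S.coeff k j y = 0 := by
  filter_upwards [h.eventually_nhds] with y hy
  by_cases hk : y ∈ (S.φ k).source
  · rw [coeff, chartDbar_congr hk (g := fun _ => c) hy, chartDbar_const, mul_zero]
  · rw [coeff, image_eq_zero_of_notMem_tsupport fun h => hk (S.tsupport_ψ k h), zero_mul]

theorem mem_source_of_mem_tsupport_coeff {k j : ι} {x : C} (hx : x ∈ tsupport (S.coeff k j)) :
    x ∈ (S.φ j).source := by
  by_contra h
  have h1 : x ∉ tsupport (S.ψ j) := fun h' => h (S.tsupport_ψ j h')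
  exact notMem_tsupport_iff_eventuallyEq.2
    (S.coeff_eventually_eq_zero (notMem_tsupport_iff_eventuallyEq.1 h1)) hx

/-- `ψ j` is constant near the support of `χ j`, so the coefficient vanishes there. The singularity
of the Cauchy kernel is thus never met where the error operator is evaluated. -/
theorem notMem_supp_of_mem_tsupport_coeff {k j : ι} {x : C} (hx : x ∈ tsupport (S.coeff k j)) :
    S.φ j x ∉ S.φ j '' tsupport (S.χ j) := by
  rintro ⟨y, hy, hxy⟩
  have := (S.φ j).injOn (S.tsupport_χ j hy) (S.mem_source_of_mem_tsupport_coeff hx) hxy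
  subst this
  exact notMem_tsupport_iff_eventuallyEq.2
    (S.coeff_eventually_eq_zero (S.eventually_ψ j y hy)) hx

/-- One entry of the matrix of the parametrix error. -/
def entry (k j : ι) (g : C(C, ι → ℂ)) (x : C) : ℂ :=
  S.coeff k j x * cauchyTransform (S.piece j g) (S.φ j x)

/-- On the support of the coefficient the Cauchy transform is holomorphic, even though `g` is only
continuous: the error operator is smoothing. -/
theorem smoothAt_entry (k j : ι) (g : C(C, ι → ℂ)) (x : C) : SmoothAt (S.entry k j g) x := by
  refine (S.smoothAt_coeff k j x).mul_of_mem_tsupport fun hy => ?_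
  refine SmoothAt.of_chart (v := cauchyTransform (S.piece j g)) (S.mem_maximalAtlas j)
    (S.mem_source_of_mem_tsupport_coeff hy) ?_
  have hopen := (S.isCompact_supp j).isClosed.isOpen_compl
  have hmem := S.notMem_supp_of_mem_tsupport_coeff hy
  have hd : DifferentiableOn ℂ (cauchyTransform (S.piece j g)) (S.φ j '' tsupport (S.χ j))ᶜ :=
    fun z hz => (differentiableAt_cauchyTransform (S.isCompact_supp j) (S.continuous_piece j g)
      (S.piece_eq_zero j g) hz).differentiableWithinAt
  exact ((hd.analyticAt (hopen.mem_nhds hmem)).contDiffAt (n := ∞)).restrict_scalars ℝ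

theorem eventually_norm_entry_sub_le (k j : ι) (x : C) {ε : ℝ} (hε : 0 < ε) :
    ∀ᶠ y in 𝓝 x, ∀ g, ‖S.entry k j g y - S.entry k j g x‖ ≤ ε * ‖g‖ := by
  by_cases hx : x ∈ tsupport (S.coeff k j)
  · have hsrc := S.mem_source_of_mem_tsupport_coeff hx
    obtain ⟨δ, hδ, h⟩ := exists_forall_le_norm_sub (S.isCompact_supp j)
      (S.notMem_supp_of_mem_tsupport_coeff hx)
    set V := MeasureTheory.volume.real (S.φ j '' tsupport (S.χ j))
    have hcφ := (S.φ j).continuousAt hsrc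
    have hcc := (S.smoothAt_coeff k j x).continuousAt
    have hlim : Tendsto (fun y => ‖S.coeff k j y‖ * (Real.pi⁻¹ * ((‖S.φ j y - S.φ j x‖ *
        (δ⁻¹ * δ⁻¹)) * V)) + ‖S.coeff k j y - S.coeff k j x‖ * (Real.pi⁻¹ * (δ⁻¹ * V)))
        (𝓝 x) (𝓝 0) := by
      have : ContinuousAt (fun y => ‖S.coeff k j y‖ * (Real.pi⁻¹ * ((‖S.φ j y - S.φ j x‖ *
        (δ⁻¹ * δ⁻¹)) * V)) + ‖S.coeff k j y - S.coeff k j x‖ * (Real.pi⁻¹ * (δ⁻¹ * V))) x := by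
        fun_prop
      simpa [ContinuousAt] using this
    filter_upwards [hlim.eventually (gt_mem_nhds hε),
      hcφ.eventually (Metric.ball_mem_nhds _ hδ)] with y hy hyb g
    have h1 := norm_cauchyTransform_sub_le (S.isCompact_supp j) (S.continuous_piece j g) hδ
      (S.norm_piece_le j g) (S.piece_eq_zero j g) (h _ hyb) (h _ (Metric.mem_ball_self hδ))
    have h2 := norm_cauchyTransform_le (S.isCompact_supp j) hδ
      (S.norm_piece_le j g) (S.piece_eq_zero j g) (h _ (Metric.mem_ball_self hδ))
    have h3 : S.entry k j g y - S.entry k j g x = S.coeff k j y *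
        (cauchyTransform (S.piece j g) (S.φ j y) - cauchyTransform (S.piece j g) (S.φ j x)) +
        (S.coeff k j y - S.coeff k j x) * cauchyTransform (S.piece j g) (S.φ j x) := by
      simp only [entry]; ring
    rw [h3]
    refine (norm_add_le _ _).trans ?_
    rw [norm_mul, norm_mul]
    refine (add_le_add (mul_le_mul_of_nonneg_left h1 (norm_nonneg _))
      (mul_le_mul_of_nonneg_left h2 (norm_nonneg _))).trans ?_
    refine le_trans (le_of_eq ?_) (mul_le_mul_of_nonneg_right hy.le (norm_nonneg g))
    ring
  · have h0 := notMem_tsupport_iff_eventuallyEq.1 hx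
    filter_upwards [h0] with y hy g
    simp only [entry, hy, h0.self_of_nhds, Pi.zero_apply, zero_mul, sub_self, norm_zero]
    positivity

/-- The error operator of the parametrix of the Cauchy–Riemann operator. -/
def errorOp : C(C, ι → ℂ) →ₗ[ℂ] C(C, ι → ℂ) where
  toFun g := ⟨fun x k => ∑ j, S.entry k j g x, continuous_pi fun k =>
    continuous_finsetSum _ fun j _ =>
      continuous_iff_continuousAt.2 fun x => (S.smoothAt_entry k j g x).continuousAt⟩
  map_add' g h := by
    refine ContinuousMap.ext fun x => funext fun k => ?_
    change ∑ j, S.entry k j (g + h) x = ∑ j, S.entry k j g x + ∑ j, S.entry k j h x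
    rw [← Finset.sum_add_distrib]
    refine Finset.sum_congr rfl fun j _ => ?_
    rw [entry, piece_add, cauchyTransform_add (S.continuous_piece j g)
      (S.hasCompactSupport_piece j g) (S.continuous_piece j h) (S.hasCompactSupport_piece j h),
      mul_add]
    rfl
  map_smul' c g := by
    refine ContinuousMap.ext fun x => funext fun k => ?_
    change ∑ j, S.entry k j (c • g) x = c * ∑ j, S.entry k j g x
    rw [Finset.mul_sum]
    refine Finset.sum_congr rfl fun j _ => ?_
    rw [entry, piece_smul, cauchyTransform_const_mul, mul_left_comm]
    rfl

theorem errorOp_apply (g : C(C, ι → ℂ)) (x : C) (k : ι) :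
    S.errorOp g x k = ∑ j, S.entry k j g x := rfl

theorem smoothAt_errorOp (g : C(C, ι → ℂ)) (k : ι) (x : C) :
    SmoothAt (fun y => S.errorOp g y k) x :=
  SmoothAt.sum _ fun j _ => S.smoothAt_entry k j g x

theorem eventually_norm_errorOp_sub_le (x : C) {ε : ℝ} (hε : 0 < ε) :
    ∀ᶠ y in 𝓝 x, ∀ g, ‖S.errorOp g y - S.errorOp g x‖ ≤ ε * ‖g‖ := by
  -- The summand `1` keeps the divisor positive when `ι` is empty.
  set n : ℝ := Fintype.card ι + 1
  have hn : 0 < n := by positivity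
  have := eventually_all.2 fun k => eventually_all.2 fun j =>
    S.eventually_norm_entry_sub_le k j x (div_pos hε hn)
  filter_upwards [this] with y hy g
  rw [pi_norm_le_iff_of_nonneg (by positivity)]
  intro k
  rw [Pi.sub_apply, errorOp_apply, errorOp_apply, ← Finset.sum_sub_distrib]
  calc ‖∑ j, (S.entry k j g y - S.entry k j g x)‖ ≤ ∑ _j : ι, ε / n * ‖g‖ :=
        norm_sum_le_of_le _ fun j _ => hy k j g
    _ = (Fintype.card ι / n) * (ε * ‖g‖) := by
        rw [Finset.sum_const, Finset.card_univ, nsmul_eq_mul]; ring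
    _ ≤ 1 * (ε * ‖g‖) := by
        gcongr
        rw [div_le_one hn]
        simp [n]
    _ = ε * ‖g‖ := one_mul _

/-- The local solution of the Cauchy–Riemann equation with right hand side `χ_j g_j dz̄_j`. -/
def localSolution (j : ι) (g : C(C, ι → ℂ)) (x : C) : ℂ :=
  S.ψ j x * cauchyTransform (S.piece j g) (S.φ j x)

theorem contDiff_transform (j : ι) {g : C(C, ι → ℂ)}
    (hg : ∀ k x, SmoothAt (fun y => g y k) x) :
    ContDiff ℝ ∞ (S.piece j g) :=
  contDiff_chartExt (S.mem_maximalAtlas j)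
    ((S.tsupport_piece j _).trans (S.tsupport_χ j)) fun x => (S.smooth_χ j x).mul' (hg j x)

theorem smoothAt_localSolution (j : ι) {g : C(C, ι → ℂ)}
    (hg : ∀ k x, SmoothAt (fun y => g y k) x) (x : C) : SmoothAt (S.localSolution j g) x :=
  (S.smooth_ψ j x).mul_of_mem_tsupport fun hx =>
    SmoothAt.of_chart (v := cauchyTransform (S.piece j g)) (S.mem_maximalAtlas j)
      (S.tsupport_ψ j hx) (contDiff_cauchyTransform (n := ⊤) (S.contDiff_transform j hg)
        (S.hasCompactSupport_piece j g)).contDiffAt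

theorem ψ_eq_one {j : ι} {x : C} (hx : S.χ j x ≠ 0) : S.ψ j x = 1 :=
  (S.eventually_ψ j x (subset_tsupport _ hx)).self_of_nhds

theorem mem_source {j : ι} {x : C} (hx : S.χ j x ≠ 0) : x ∈ (S.φ j).source :=
  S.tsupport_χ j (subset_tsupport _ hx)

theorem exists_mem_source (x : C) : ∃ k, x ∈ (S.φ k).source := by
  by_contra! h
  have h1 := S.sum_χ x
  rw [Finset.sum_eq_zero fun k _ => by_contra fun hk => h k (S.mem_source hk)] at h1
  exact zero_ne_one h1

/-- By the product rule, `∂̄(ψ K) = K ∂̄ψ + ψ ∂̄K`. The second term is the desired form, since `ψ =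
1` on the support of `χ`; the first is the error. -/
theorem chartDbar_localSolution (j : ι) {g : C(C, ι → ℂ)}
    (hg : ∀ k x, SmoothAt (fun y => g y k) x) {φ : OpenPartialHomeomorph C ℂ}
    (hφ : φ ∈ IsManifold.maximalAtlas 𝓘(ℂ) ω C) {x : C} (hx : x ∈ φ.source) :
    chartDbar φ (S.localSolution j g) x =
      chartDbar φ (S.ψ j) x * cauchyTransform (S.piece j g) (S.φ j x) +
        S.χ j x * g x j * (starRingEnd ℂ) (chartJac (S.φ j) φ x) := by
  by_cases hj : x ∈ (S.φ j).source
  · have hK : ContDiff ℝ ∞ (cauchyTransform (S.piece j g)) := contDiff_cauchyTransform (n := ⊤)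
      (S.contDiff_transform j hg) (S.hasCompactSupport_piece j g)
    have h1 := chartDbar_mul hφ hx (S.smooth_ψ j x)
      (SmoothAt.of_chart (v := cauchyTransform (S.piece j g)) (S.mem_maximalAtlas j) hj
        hK.contDiffAt)
    have h2 := chartDbar_comp_chart (S.mem_maximalAtlas j) hφ hj hx
      (hK.contDiffAt.differentiableAt (x := S.φ j x) (by simp))
    rw [dbar_cauchyTransform ((S.contDiff_transform j hg).of_le (by simp))
      (S.hasCompactSupport_piece j g), piece, chartExt_apply hj] at h2
    refine h1.trans ?_
    rw [piece, h2]
    congr 1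
    by_cases hχ : S.χ j x = 0
    · simp [hχ]
    · rw [S.ψ_eq_one hχ, one_mul]
  · have h1 : x ∉ tsupport (S.ψ j) := fun h => hj (S.tsupport_ψ j h)
    have h2 := notMem_tsupport_iff_eventuallyEq.1 h1
    have h3 : S.χ j x = 0 := by_contra fun h => hj (S.mem_source h)
    rw [chartDbar_congr hx (g := fun _ => 0) h2, chartDbar_const, h3,
      chartDbar_congr hx (g := fun _ => 0) (f := S.localSolution j g), chartDbar_const]
    · simp
    · filter_upwards [h2] with y hy
      simp [localSolution, hy]

/-- If a family of smooth functions satisfies finitely many linear conditions, then the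
corresponding form of type `(0, 1)` is `∂̄`-exact. -/
theorem exists_solution : ∃ (s : Finset C) (Λ : C(C, ι → ℂ) →ₗ[ℂ] (s → ι → ℂ)),
    ∀ h, Λ h = 0 → (∀ k x, SmoothAt (fun y => h y k) x) →
      ∃ u : C → ℂ, (∀ x, SmoothAt u x) ∧ ∀ φ ∈ IsManifold.maximalAtlas 𝓘(ℂ) ω C,
        ∀ x ∈ φ.source, chartDbar φ u x =
          ∑ l, S.χ l x * h x l * (starRingEnd ℂ) (chartJac (S.φ l) φ x) := by
  obtain ⟨s, Λ, hΛ⟩ := exists_ker_le_range_one_add S.errorOp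
    fun x ε hε => S.eventually_norm_errorOp_sub_le x hε
  refine ⟨s, Λ, fun h h0 hh => ?_⟩
  obtain ⟨g, hg⟩ := hΛ h h0
  -- Regularity for free: `g = h - T g`, and `T g` is smooth for every continuous `g`.
  have hg' : ∀ k x, SmoothAt (fun y => g y k) x := fun k x => by
    have : g = h - S.errorOp g := eq_sub_of_add_eq hg
    have h2 : (fun y => g y k) = fun y => h y k - S.errorOp g y k := by
      conv_lhs => rw [this]
      rfl
    rw [h2]
    exact (hh k x).sub' (S.smoothAt_errorOp g k x)
  refine ⟨fun x => ∑ j, S.localSolution j g x,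
    fun x => SmoothAt.sum _ fun j _ => S.smoothAt_localSolution j hg' x, fun φ hφ x hx => ?_⟩
  rw [chartDbar_sum hφ _ hx fun j _ => S.smoothAt_localSolution j hg' x]
  simp only [S.chartDbar_localSolution _ hg' hφ hx]
  have h1 : ∀ l, h x l = g x l + ∑ j, S.entry l j g x := fun l => by rw [← hg]; rfl
  simp only [h1, mul_add, add_mul, Finset.sum_add_distrib]
  rw [add_comm]
  congr 1
  -- The error form `∑ j, K_j ∂̄ψ_j` does not depend on the chart. Its component in chart `l`,
  -- weighted by `χ l`, transforms back to `χ l` times the form, and the weights sum to `1`.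
  have h2 : ∀ l, S.χ l x * (∑ j, S.entry l j g x) * (starRingEnd ℂ) (chartJac (S.φ l) φ x) =
      S.χ l x * ∑ j, chartDbar φ (S.ψ j) x * cauchyTransform (S.piece j g) (S.φ j x) := by
    intro l
    by_cases hχ : S.χ l x = 0
    · simp [hχ]
    · rw [mul_assoc, Finset.sum_mul]
      congr 1
      refine Finset.sum_congr rfl fun j _ => ?_
      rw [entry, coeff, S.ψ_eq_one hχ, one_mul, chartDbar_change (S.mem_maximalAtlas l) hφ
        (S.mem_source hχ) hx (S.smooth_ψ j x)]
      ring
  simp only [h2]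
  rw [← Finset.sum_mul, S.sum_χ, one_mul]

end CutoffSystem

end Operator

/-! ### Orders of sums of meromorphic germs. -/

section Order

open Set Filter

theorem lt_meromorphicOrderAt_sum {ι : Type*} (s : Finset ι) (f : ι → ℂ → ℂ) {a : ℤ}
    (hf : ∀ i ∈ s, MeromorphicAt (f i) 0)
    (h : ∀ i ∈ s, (a : WithTop ℤ) < meromorphicOrderAt (f i) 0) :
    (a : WithTop ℤ) < meromorphicOrderAt (∑ i ∈ s, f i) 0 := by
  classical
  induction s using Finset.induction_on with
  | empty =>
    have : meromorphicOrderAt (0 : ℂ → ℂ) 0 = ⊤ := by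
      rw [meromorphicOrderAt_eq_top_iff]; simp
    rw [Finset.sum_empty, this]
    exact WithTop.coe_lt_top a
  | insert i s hi ih =>
    rw [Finset.sum_insert hi]
    refine lt_of_lt_of_le (lt_min (h i (Finset.mem_insert_self i s))
      (ih (fun j hj => hf j (Finset.mem_insert_of_mem hj))
        fun j hj => h j (Finset.mem_insert_of_mem hj)))
      (meromorphicOrderAt_add (hf i (Finset.mem_insert_self i s))
        (MeromorphicAt.sum fun j hj => hf j (Finset.mem_insert_of_mem hj)))

theorem meromorphicOrderAt_const_mul {f : ℂ → ℂ} {c : ℂ} (hc : c ≠ 0) (hf : MeromorphicAt f 0) :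
    meromorphicOrderAt (fun w => c * f w) 0 = meromorphicOrderAt f 0 := by
  classical
  have := meromorphicOrderAt_mul (MeromorphicAt.const c 0) hf
  rw [meromorphicOrderAt_const, if_neg hc, zero_add] at this
  exact this

/-- The order of a linear combination of functions with poles of different orders. -/
theorem exists_meromorphicOrderAt_linearCombination {f : ℕ → ℂ → ℂ} {c : ℕ →₀ ℂ} (hc : c ≠ 0)
    (hf : ∀ n ∈ c.support, MeromorphicAt (f n) 0)
    (hord : ∀ n ∈ c.support, meromorphicOrderAt (f n) 0 = ((-(n : ℤ) : ℤ) : WithTop ℤ)) :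
    ∃ m ∈ c.support,
      meromorphicOrderAt (fun w => ∑ n ∈ c.support, c n * f n w) 0 = ((-(m : ℤ) : ℤ) : WithTop ℤ) := by
  have hne : c.support.Nonempty := Finsupp.support_nonempty_iff.2 hc
  set m := c.support.max' hne
  have hm : m ∈ c.support := Finset.max'_mem _ hne
  have hmer : ∀ n ∈ c.support, MeromorphicAt (fun w => c n * f n w) 0 := fun n hn =>
    (MeromorphicAt.const (c n) 0).mul (hf n hn)
  have hord' : ∀ n ∈ c.support, meromorphicOrderAt (fun w => c n * f n w) 0 =
      ((-(n : ℤ) : ℤ) : WithTop ℤ) := fun n hn => by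
    rw [meromorphicOrderAt_const_mul (Finsupp.mem_support_iff.1 hn) (hf n hn), hord n hn]
  refine ⟨m, hm, ?_⟩
  -- The term with the largest index `m` has the strictly smallest order, hence dominates.
  have h1 : (fun w => ∑ n ∈ c.support, c n * f n w) =
      (fun w => c m * f m w) + ∑ n ∈ c.support.erase m, fun w => c n * f n w := by
    rw [Finset.add_sum_erase _ (fun n w => c n * f n w) hm]
    ext w
    simp
  rw [h1, meromorphicOrderAt_add_eq_left_of_lt, hord' m hm]
  · exact MeromorphicAt.sum fun n hn => hmer n (Finset.mem_of_mem_erase hn)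
  · rw [hord' m hm]
    refine lt_meromorphicOrderAt_sum _ _ (fun n hn => hmer n (Finset.mem_of_mem_erase hn))
      fun n hn => ?_
    rw [hord' n (Finset.mem_of_mem_erase hn), WithTop.coe_lt_coe, neg_lt_neg_iff, Nat.cast_lt]
    exact lt_of_le_of_ne (Finset.le_max' _ n (Finset.mem_of_mem_erase hn))
      (Finset.ne_of_mem_erase hn)

theorem meromorphicOrderAt_inv_pow (n : ℕ) :
    meromorphicOrderAt (fun w : ℂ => w ^ (-(n : ℤ))) 0 = ((-(n : ℤ) : ℤ) : WithTop ℤ) := by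
  have h : MeromorphicAt (fun w : ℂ => w ^ (-(n : ℤ))) 0 := (MeromorphicAt.id 0).zpow _
  rw [meromorphicOrderAt_eq_int_iff h]
  exact ⟨fun _ => 1, analyticAt_const, one_ne_zero, Eventually.of_forall fun w => by simp⟩

end Order

/-! ### Functions with one pole of prescribed large order. -/

section Poles

open Set Filter

set_option linter.unusedSectionVars false

variable {C : Type u} [TopologicalSpace C] [T2Space C] [CompactSpace C] [ChartedSpace ℂ C]
  [IsManifold 𝓘(ℂ) ω C] {p : C} (z : LocalCoordinate p)

/-- The function `z⁻ⁿ`, multiplied by a cutoff function. -/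
def principalPart (κ : C → ℂ) (n : ℕ) (x : C) : ℂ := κ x * z.chart x ^ (-(n : ℤ))

variable {κ : C → ℂ} (hκ : ∀ x, SmoothAt κ x) (hκ1 : ∀ᶠ y in 𝓝 p, κ y = 1)
  (hκs : tsupport κ ⊆ z.chart.source)

theorem chart_ne_zero {x : C} (hx : x ∈ z.chart.source) (hxp : x ≠ p) : z.chart x ≠ 0 :=
  fun h => hxp (z.chart.injOn hx z.mem_source (h.trans z.map_center.symm))

include hκ hκs in
theorem smoothAt_principalPart (n : ℕ) {x : C} (hxp : x ≠ p) :
    SmoothAt (principalPart z κ n) x :=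
  (hκ x).mul_of_mem_tsupport fun hx => SmoothAt.of_chart (v := fun w => w ^ (-(n : ℤ)))
    z.mem_maximalAtlas (hκs hx) (by
      have h0 := chart_ne_zero z (hκs hx) hxp
      have h1 : ContDiffAt ℂ ∞ (fun w : ℂ => w ^ (-(n : ℤ))) (z.chart x) :=
        ((analyticAt_id (𝕜 := ℂ)).fun_zpow h0).contDiffAt
      exact h1.restrict_scalars ℝ)

include hκ1 in
-- Near `p`, but off `p`, the cutoff is `1` and `z⁻ⁿ` is holomorphic.
theorem eventually_chartDbar_principalPart (n : ℕ) {φ : OpenPartialHomeomorph C ℂ}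
    (hφ : φ ∈ IsManifold.maximalAtlas 𝓘(ℂ) ω C) :
    ∀ᶠ x in 𝓝 p, x ≠ p → x ∈ φ.source → chartDbar φ (principalPart z κ n) x = 0 := by
  filter_upwards [hκ1.eventually_nhds, z.chart.open_source.mem_nhds z.mem_source]
    with x hx hxs hxp hxφ
  have h1 : principalPart z κ n =ᶠ[𝓝 x] (fun w => w ^ (-(n : ℤ))) ∘ z.chart := by
    filter_upwards [hx] with y hy
    simp [principalPart, hy]
  rw [chartDbar_congr hxφ h1]
  refine chartDbar_eq_zero_of_mdifferentiableAt hφ hxφ ?_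
  refine MDifferentiableAt.comp x ?_
    ((contMDiffAt_of_mem_maximalAtlas z.mem_maximalAtlas hxs).mdifferentiableAt (by simp))
  exact ((analyticAt_id (𝕜 := ℂ)).fun_zpow
    (chart_ne_zero z hxs hxp)).differentiableAt.mdifferentiableAt

variable {ι : Type u} [Fintype ι] (S : CutoffSystem C ι)

open Classical in
/-- The components of the `(0, 1)`-form `∂̄` of the cut off principal part. -/
def principalForm (κ : C → ℂ) (n : ℕ) (k : ι) (x : C) : ℂ :=
  if x = p then 0 else S.ψ k x * chartDbar (S.φ k) (principalPart z κ n) x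

include hκ1 in
theorem eventually_principalForm_eq_zero (n : ℕ) (k : ι) :
    ∀ᶠ x in 𝓝 p, principalForm z S κ n k x = 0 := by
  filter_upwards [eventually_chartDbar_principalPart z hκ1 n (S.mem_maximalAtlas k)] with x hx
  rw [principalForm]
  split_ifs with hxp
  · rfl
  · by_cases hxk : x ∈ (S.φ k).source
    · rw [hx hxp hxk, mul_zero]
    · rw [image_eq_zero_of_notMem_tsupport fun h => hxk (S.tsupport_ψ k h), zero_mul]

include hκ hκ1 hκs in
-- The form vanishes in a punctured neighbourhood of `p`; with the value `0` at `p` it is smooth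
-- there although the principal part itself has a pole.
theorem smoothAt_principalForm (n : ℕ) (k : ι) (x : C) :
    SmoothAt (principalForm z S κ n k) x := by
  by_cases hxp : x = p
  · subst hxp
    exact (contMDiffAt_const (c := (0 : ℂ))).congr_of_eventuallyEq
      (eventually_principalForm_eq_zero z hκ1 S n k)
  · have h1 : SmoothAt (fun y => S.ψ k y * chartDbar (S.φ k) (principalPart z κ n) y) x :=
      (S.smooth_ψ k x).mul_of_mem_tsupport fun hx =>
        (smoothAt_principalPart z hκ hκs n hxp).chartDbar (S.mem_maximalAtlas k)
          (S.tsupport_ψ k hx)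
    refine h1.congr_of_eventuallyEq ?_
    filter_upwards [isOpen_ne.mem_nhds hxp] with y hy
    rw [principalForm, if_neg hy]

theorem mdifferentiable_restrict_punctured {f : C → ℂ}
    (hf : ∀ x, x ≠ p → MDifferentiableAt 𝓘(ℂ) 𝓘(ℂ) f x) :
    MDifferentiable 𝓘(ℂ) 𝓘(ℂ) fun x : punctured p => f x := fun x =>
  (hf x x.2).comp x ((contMDiff_subtype_val (n := 1)).mdifferentiable one_ne_zero x)

theorem analyticAt_comp_chart_symm {u : C → ℂ}
    (hu : ∀ᶠ x in 𝓝 p, MDifferentiableAt 𝓘(ℂ) 𝓘(ℂ) u x) :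
    AnalyticAt ℂ (fun w => u (z.chart.symm w)) 0 := by
  have h0 : (0 : ℂ) ∈ z.chart.target := z.map_center ▸ z.chart.map_source z.mem_source
  have hs : z.chart.symm 0 = p := by rw [← z.map_center, z.chart.left_inv z.mem_source]
  rw [Complex.analyticAt_iff_eventually_differentiableAt]
  have hc := z.chart.continuousAt_symm h0
  rw [ContinuousAt, hs] at hc
  filter_upwards [hc.eventually hu, z.chart.open_target.mem_nhds h0] with w hw hwt
  exact (hw.comp w ((contMDiffAt_symm_of_mem_maximalAtlas z.mem_maximalAtlas
    hwt).mdifferentiableAt (by simp))).differentiableAt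

/-- All but finitely many positive integers are pole orders of functions in `affineRing z`. -/
theorem finite_setOf_gaps : {n : ℕ | 0 < n ∧ ¬ ∃ f ∈ affineRing z,
    meromorphicOrderAt (localExpr z f) 0 = ((-(n : ℤ) : ℤ) : WithTop ℤ)}.Finite := by
  obtain ⟨ι, _, ⟨S⟩⟩ := exists_cutoffSystem (C := C)
  obtain ⟨κ, hκ, hκ1, hκs⟩ := exists_smooth_cutoff (isClosed_singleton (x := p))
    z.chart.open_source (singleton_subset_iff.2 z.mem_source)
  replace hκ1 := hκ1 p rfl
  obtain ⟨s, Λ, hΛ⟩ := S.exists_solution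
  have hsm := smoothAt_principalForm z hκ hκ1 hκs S
  let h : ℕ → C(C, ι → ℂ) := fun n => ⟨fun x k => principalForm z S κ n k x,
    continuous_pi fun k => continuous_iff_continuousAt.2 fun x => (hsm n k x).continuousAt⟩
  -- The vector attached to `n` is the obstruction to solving `∂̄u = ∂̄(κ z⁻ⁿ)`. A nontrivial
  -- relation among the obstructions of missing orders has to be refuted.
  refine finite_of_forall_linearCombination_ne_zero (fun n => Λ (h n)) _ fun c hc hsupp h0 => ?_
  have hval : ∀ x k, Finsupp.linearCombination ℂ h c x k =
      ∑ n ∈ c.support, c n * principalForm z S κ n k x := fun x k => by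
    rw [Finsupp.linearCombination_apply, Finsupp.sum, ContinuousMap.coe_sum, Finset.sum_apply,
      Finset.sum_apply]
    rfl
  obtain ⟨u, hu, hdu⟩ := hΛ (Finsupp.linearCombination ℂ h c)
    (by rw [Finsupp.apply_linearCombination]; exact h0) (fun k x => by
      simp only [hval]
      exact SmoothAt.sum _ fun n _ => (hsm n k x).const_mul (c n))
  have hsum : ∀ x, x ≠ p → SmoothAt (fun y => ∑ n ∈ c.support, c n * principalPart z κ n y) x :=
    fun x hx => SmoothAt.sum _ fun n _ => (smoothAt_principalPart z hκ hκs n hx).const_mul (c n)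
  let f : C → ℂ := fun x => ∑ n ∈ c.support, c n * principalPart z κ n x - u x
  have hf : ∀ x, x ≠ p → MDifferentiableAt 𝓘(ℂ) 𝓘(ℂ) f x := fun x hx => by
    obtain ⟨k, hk⟩ := S.exists_mem_source x
    have hφ := S.mem_maximalAtlas k
    refine mdifferentiableAt_of_chartDbar_eq_zero hφ hk ((hsum x hx).sub' (hu x)) ?_
    rw [chartDbar_sub hφ hk (hsum x hx) (hu x), hdu _ hφ x hk, sub_eq_zero]
    have h1 : ∀ l, S.χ l x * Finsupp.linearCombination ℂ h c x l *
        (starRingEnd ℂ) (chartJac (S.φ l) (S.φ k) x) =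
        S.χ l x * chartDbar (S.φ k) (fun y => ∑ n ∈ c.support, c n * principalPart z κ n y) x := by
      intro l
      by_cases hχ : S.χ l x = 0
      · simp [hχ]
      · have hl := S.mem_source hχ
        rw [chartDbar_change (S.mem_maximalAtlas l) hφ hl hk (hsum x hx), hval, mul_assoc,
          chartDbar_sum (S.mem_maximalAtlas l) _ hl
            fun n _ => (smoothAt_principalPart z hκ hκs n hx).const_mul (c n)]
        congr 2
        refine Finset.sum_congr rfl fun n _ => ?_
        rw [chartDbar_const_mul (S.mem_maximalAtlas l) _ hl (smoothAt_principalPart z hκ hκs n hx),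
          principalForm, if_neg hx, S.ψ_eq_one hχ, one_mul]
    simp only [h1]
    rw [← Finset.sum_mul, S.sum_χ, one_mul]
  -- The right-hand side vanishes near `p`, so `u` is holomorphic there and leaves the polar part of
  -- `f` unchanged.
  have hup : ∀ᶠ x in 𝓝 p, MDifferentiableAt 𝓘(ℂ) 𝓘(ℂ) u x := by
    have h1 : ∀ᶠ x in 𝓝 p, ∀ n ∈ c.support, ∀ k, principalForm z S κ n k x = 0 :=
      (eventually_all_finset _).2 fun n _ => eventually_all.2 fun k =>
        eventually_principalForm_eq_zero z hκ1 S n k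
    obtain ⟨k, hk⟩ := S.exists_mem_source p
    filter_upwards [h1, (S.φ k).open_source.mem_nhds hk] with x hx hxk
    refine mdifferentiableAt_of_chartDbar_eq_zero (S.mem_maximalAtlas k) hxk (hu x) ?_
    rw [hdu _ (S.mem_maximalAtlas k) x hxk]
    refine Finset.sum_eq_zero fun l _ => ?_
    rw [hval, Finset.sum_eq_zero fun n hn => by rw [hx n hn l, mul_zero], mul_zero, zero_mul]
  have han := analyticAt_comp_chart_symm z hup
  have hloc : localExpr z (fun x : punctured p => f x) =ᶠ[𝓝[≠] 0]
      (fun w => ∑ n ∈ c.support, c n * w ^ (-(n : ℤ))) + -fun w => u (z.chart.symm w) := by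
    have h0 : (0 : ℂ) ∈ z.chart.target := z.map_center ▸ z.chart.map_source z.mem_source
    have hs : z.chart.symm 0 = p := by rw [← z.map_center, z.chart.left_inv z.mem_source]
    have hcs := z.chart.continuousAt_symm h0
    rw [ContinuousAt, hs] at hcs
    filter_upwards [eventually_mem_punctured z, nhdsWithin_le_nhds (hcs.eventually hκ1),
      nhdsWithin_le_nhds (z.chart.open_target.mem_nhds h0)] with w hw hw1 hwt
    have hw' : localExpr z (fun x : punctured p => f x) w = f (z.chart.symm w) := by
      rw [localExpr, dif_pos hw]
    rw [hw']
    simp only [f, principalPart, hw1, one_mul, z.chart.right_inv hwt, Pi.add_apply, Pi.neg_apply,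
      sub_eq_add_neg]
  have hzp : ∀ n : ℕ, MeromorphicAt (fun w : ℂ => w ^ (-(n : ℤ))) 0 := fun n =>
    (MeromorphicAt.id 0).zpow _
  obtain ⟨m, hm, hord⟩ := exists_meromorphicOrderAt_linearCombination hc (fun n _ => hzp n)
    (fun n _ => meromorphicOrderAt_inv_pow n)
  -- The pole order of `f` is the largest index `m` of the relation, which was supposed to be
  -- missing. Positivity of `m` ensures that `u` has larger order than the polar part.
  refine (hsupp m hm).2 ⟨fun x => f x, ⟨mdifferentiable_restrict_punctured hf, ?_⟩, ?_⟩
  · refine MeromorphicAt.congr ?_ hloc.symm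
    exact (MeromorphicAt.fun_sum fun n _ => (MeromorphicAt.const (c n) 0).mul (hzp n)).add
      han.meromorphicAt.neg
  · rw [meromorphicOrderAt_congr hloc, meromorphicOrderAt_add_eq_left_of_lt, hord]
    · exact han.meromorphicAt.neg
    · rw [hord]
      refine lt_of_lt_of_le ?_ han.neg.meromorphicOrderAt_nonneg
      have := (hsupp m hm).1
      exact_mod_cast (by omega : -(m : ℤ) < 0)

theorem localExpr_sum {ι' : Type*} (s : Finset ι') (f : ι' → punctured p → ℂ) (c : ι' → ℂ) (w : ℂ) :
    localExpr z (∑ i ∈ s, c i • f i) w = ∑ i ∈ s, c i * localExpr z (f i) w := by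
  simp only [localExpr]
  split_ifs <;> simp

/-- Every large integer is the pole order of a function in `affineRing z` that vanishes at finitely
many given points. -/
theorem exists_vanishing_of_large {κ : Type*} [Fintype κ] (q : κ → punctured p) :
    ∃ N₀ : ℕ, ∀ n : ℕ, N₀ ≤ n → ∃ f ∈ affineRing z, (∀ i, f (q i) = 0) ∧
      meromorphicOrderAt (localExpr z f) 0 = ((-(n : ℤ) : ℤ) : WithTop ℤ) := by
  classical
  set P : ℕ → Prop := fun n => ∃ f ∈ affineRing z,
    meromorphicOrderAt (localExpr z f) 0 = ((-(n : ℤ) : ℤ) : WithTop ℤ)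
  choose f hfR hford using fun n : {n // P n} => n.2
  let g : ℕ → punctured p → ℂ := fun n => if h : P n then f ⟨n, h⟩ else 0
  have hg : ∀ n, P n → g n ∈ affineRing z ∧
      meromorphicOrderAt (localExpr z (g n)) 0 = ((-(n : ℤ) : ℤ) : WithTop ℤ) := fun n hn => by
    simp only [g, dif_pos hn]
    exact ⟨hfR ⟨n, hn⟩, hford ⟨n, hn⟩⟩
  have hfin : {n : ℕ | P n ∧ ¬ ∃ f ∈ affineRing z, (∀ i, f (q i) = 0) ∧
      meromorphicOrderAt (localExpr z f) 0 = ((-(n : ℤ) : ℤ) : WithTop ℤ)}.Finite := by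
    -- Now the obstruction vector of `n` consists of the values of `g n` at the given points. A
    -- relation yields a function that vanishes at them and has as pole order the largest index
    -- involved.
    refine finite_of_forall_linearCombination_ne_zero (fun n i => g n (q i)) _
      fun c hc hsupp h0 => ?_
    obtain ⟨m, hm, hord⟩ := exists_meromorphicOrderAt_linearCombination hc
      (fun n hn => (hg n (hsupp n hn).1).1.2) (fun n hn => (hg n (hsupp n hn).1).2)
    refine (hsupp m hm).2 ⟨∑ n ∈ c.support, c n • g n, Subalgebra.sum_mem _ fun n hn =>
      Subalgebra.smul_mem _ (hg n (hsupp n hn).1).1 _, fun i => ?_, ?_⟩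
    · have := congrFun h0 i
      rw [Finsupp.linearCombination_apply, Finsupp.sum, Finset.sum_apply] at this
      rw [Finset.sum_apply]
      exact this
    · rw [← hord]
      congr 1
      ext w
      exact localExpr_sum z _ _ _ w
  obtain ⟨N₁, h1⟩ := (finite_setOf_gaps z).bddAbove
  obtain ⟨N₂, h2⟩ := hfin.bddAbove
  -- Beyond both bounds; the summand `1` also makes `n` positive, as the definition of a gap
  -- demands.
  refine ⟨max N₁ N₂ + 1, fun n hn => ?_⟩
  have hP : P n := by
    by_contra h
    have := h1 ⟨by omega, h⟩
    omega
  by_contra h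
  have := h2 ⟨hP, h⟩
  omega

end Poles

/-! ### Morphisms to `Proj` that land in one affine chart. -/

section Proj

open CategoryTheory HomogeneousLocalization

variable {A : Type u} [CommRing A] {σ : Type*} [SetLike σ A] [AddSubgroupClass σ A]
  (𝒜 : ℕ → σ) [GradedRing 𝒜]

/-- A ring homomorphism that maps `t` to a unit, on the homogeneous localization away from `t`. -/
def awayLift {R : Type*} [CommRing R] (f : A →+* R) {t : A} (ht : IsUnit (f t)) :
    Away 𝒜 t →+* R :=
  (IsLocalization.Away.lift (S := Localization.Away t) t ht).comp
    (algebraMap (Away 𝒜 t) (Localization.Away t))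

theorem awayLift_mk_mul {R : Type*} [CommRing R] (f : A →+* R) {t : A} (ht : IsUnit (f t)) {d : ℕ}
    (hd : t ∈ 𝒜 d) (n : ℕ) (x : A) (hx : x ∈ 𝒜 (n • d)) :
    awayLift 𝒜 f ht (Away.mk 𝒜 hd n x hx) * f t ^ n = f x := by
  have h : IsLocalization.Away.lift (S := Localization.Away t) t ht (Localization.mk x
      ⟨t ^ n, n, rfl⟩) * f t ^ n = f x := by
    rw [Localization.mk_eq_mk', IsLocalization.Away.lift]
    have := (IsLocalization.lift_mk'_spec (S := Localization.Away t) (M := .powers t) (g := f)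
      (hg := fun y => by obtain ⟨_, k, rfl⟩ := y; simpa using ht.pow k) x _ ⟨t ^ n, n, rfl⟩).1 rfl
    rw [this, map_pow, mul_comm]
  rw [← h, awayLift, RingHom.comp_apply, HomogeneousLocalization.algebraMap_apply, Away.val_mk]

/-- Since `f t` is a unit, the locus where it does not vanish is all of `X`. The local description
of the morphism over `D₊(t)` is then a global one. -/
theorem fromOfGlobalSections_eq_toSpecΓ_comp {X : Scheme.{u}} (f : A →+* Γ(X, ⊤))
    (hf : (HomogeneousIdeal.irrelevant 𝒜).toIdeal.map f = ⊤) {t : A} {d : ℕ} (h0d : 0 < d)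
    (hd : t ∈ 𝒜 d) (ht : IsUnit (f t)) :
    Proj.fromOfGlobalSections 𝒜 f hf =
      X.toSpecΓ ≫ Spec.map (CommRingCat.ofHom (awayLift 𝒜 f ht)) ≫ Proj.awayι 𝒜 t hd h0d := by
  have htop : X.basicOpen (f t) = ⊤ := X.basicOpen_of_isUnit ht
  have hiso : IsIso (X.basicOpen (f t)).ι := by
    rw [htop, ← Scheme.topIso_hom]
    infer_instance
  rw [← cancel_epi (X.basicOpen (f t)).ι, ← Scheme.Hom.resLE_comp_ι _
    (Proj.fromOfGlobalSections_preimage_basicOpen 𝒜 f hf h0d hd).ge,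
    Proj.fromOfGlobalSections_resLE 𝒜 f hf h0d hd]
  have hle : Submonoid.powers t ≤ (Submonoid.powers (f t)).comap f := by
    rw [← Submonoid.map_le_iff_le_comap, Submonoid.map_powers]
  have key : (IsLocalization.map (Localization.Away (f t)) f hle :
      Localization.Away t →+* Localization.Away (f t)) = (algebraMap _ _).comp
        (IsLocalization.Away.lift (S := Localization.Away t) t ht) := by
    apply IsLocalization.ringHom_ext (M := .powers t)
    ext i
    simp
  rw [Proj.toBasicOpenOfGlobalSections, key, RingHom.comp_assoc, CommRingCat.ofHom_comp,
    Spec.map_comp]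
  simp only [Category.assoc]
  rw [Proj.basicOpenIsoSpec_inv_ι, Iso.inv_comp_eq, Scheme.isoOfEq_hom_ι_assoc]
  have h := basicOpenIsoSpecAway_hom_SpecMap (R := Γ(X, ⊤)) (f t)
  refine Eq.trans ?_ (morphismRestrict_ι_assoc X.toSpecΓ
    (PrimeSpectrum.basicOpen (f t) : TopologicalSpace.Opens (PrimeSpectrum Γ(X, ⊤))) _)
  congr 1
  refine (Category.assoc _ _ _).symm.trans ?_
  exact congrArg (· ≫ Spec.map (CommRingCat.ofHom (awayLift 𝒜 f ht)) ≫ Proj.awayι 𝒜 t hd h0d) h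

end Proj

/-! ### The homogeneous primes of the graded ring of a pole filtration. -/

section Algebra

variable {S : Type u} [CommRing S] [Algebra ℂ S]

/-- A filtration that behaves like the filtration by the order of the pole at a point. -/
structure IsPoleFiltration (F : ℤ → Submodule ℂ S) [IsRingFiltration F] : Prop where
  exists_sub_smul_mem : ∀ (n : ℤ) (x y : S), x ∈ F n → y ∈ F n → y ∉ F (n - 1) →
    ∃ c : ℂ, x - c • y ∈ F (n - 1)
  mul_notMem : ∀ (m n : ℤ) (x y : S), x ∈ F m → x ∉ F (m - 1) → y ∈ F n → y ∉ F (n - 1) →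
    x * y ∉ F (m + n - 1)
  one_notMem : (1 : S) ∉ F (-1)
  exists_pos : ∃ n : ℕ, 0 < n ∧ ∃ x ∈ F (n : ℤ), x ∉ F ((n : ℤ) - 1)
  exhaustive : ∀ x : S, ∃ n : ℕ, x ∈ F (n : ℤ)

variable (F : ℤ → Submodule ℂ S) [IsRingFiltration F]

theorem homog_congr {m n : ℕ} {x y : S} (hmn : m = n) (hxy : x = y) (hx : x ∈ F (m : ℤ))
    (hy : y ∈ F (n : ℤ)) : homog F m x hx = homog F n y hy := by
  subst hmn hxy
  rfl

theorem natPart_mul_mem {m n : ℕ} {x y : S} (hx : x ∈ F (m : ℤ)) (hy : y ∈ F (n : ℤ)) :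
    x * y ∈ F ((m + n : ℕ) : ℤ) :=
  SetLike.GradedMul.mul_mem (A := natPart F) hx hy

theorem natPart_pow_mem {m : ℕ} {x : S} (hx : x ∈ F (m : ℤ)) (k : ℕ) :
    x ^ k ∈ F ((k * m : ℕ) : ℤ) := by
  exact SetLike.pow_mem_graded (A := natPart F) k hx

theorem homog_pow {m : ℕ} {x : S} (hx : x ∈ F (m : ℤ)) (k : ℕ) :
    homog F m x hx ^ k = homog F (k * m) (x ^ k) (natPart_pow_mem F hx k) := by
  induction k with
  | zero =>
    rw [pow_zero]
    exact homog_congr F (by simp) (by simp) IsRingFiltration.one_mem _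
  | succ k ih =>
    rw [pow_succ, ih, homog_mul F _ _ _ _ _ _ (natPart_mul_mem F (natPart_pow_mem F hx k) hx)]
    exact homog_congr F (by ring) (by ring) _ _

theorem homog_add {n : ℕ} {x y : S} (hx : x ∈ F (n : ℤ)) (hy : y ∈ F (n : ℤ)) :
    homog F n x hx + homog F n y hy = homog F n (x + y) (add_mem hx hy) :=
  ((inclusion F n).map_add ⟨x, hx⟩ ⟨y, hy⟩).symm

theorem homog_smul_mem {I : Ideal (GradedSum F)} {n : ℕ} {x : S} (hx : x ∈ F (n : ℤ)) (c : ℂ)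
    (h : homog F n x hx ∈ I) : homog F n (c • x) ((F n).smul_mem c hx) ∈ I := by
  have hc : algebraMap ℂ S c ∈ F ((0 : ℕ) : ℤ) := by
    rw [Algebra.algebraMap_eq_smul_one]
    exact (F _).smul_mem c IsRingFiltration.one_mem
  have := I.mul_mem_left (homog F 0 _ hc) h
  rw [homog_mul F _ _ _ _ _ _ (natPart_mul_mem F hc hx)] at this
  convert this using 1
  exact homog_congr F (by simp) (Algebra.smul_def c x) _ _

theorem exists_eq_homog {n : ℕ} {y : GradedSum F} (hy : y ∈ grading F n) :
    ∃ (x : S) (hx : x ∈ F (n : ℤ)), y = homog F n x hx := by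
  obtain ⟨x, rfl⟩ := hy
  exact ⟨x.1, x.2, rfl⟩

theorem decompose_eq_homog (y : GradedSum F) (n : ℕ) :
    (DirectSum.decompose (grading F) y n : GradedSum F) =
      homog F n (component F n y) (component F n y).2 := by
  induction y using gradedSum_induction with
  | h0 =>
    rw [DirectSum.decompose_zero]
    exact (map_zero (inclusion F n)).symm
  | h1 m x hx =>
    by_cases h : m = n
    · subst h
      rw [DirectSum.decompose_of_mem_same _ (homog_mem F m x hx)]
      refine homog_congr F rfl ?_ _ _
      rw [component_homog_self]
    · rw [DirectSum.decompose_of_mem_ne _ (homog_mem F m x hx) h]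
      refine Eq.trans (map_zero (inclusion F n)).symm ?_
      refine congrArg (inclusion F n) ?_
      rw [component_homog_of_ne F h]
  | h2 y y' hy hy' =>
    rw [DirectSum.decompose_add, DirectSum.add_apply, AddMemClass.coe_add, hy, hy', homog_add]
    exact homog_congr F rfl (by simp) _ _

theorem homog_mem_inftyIdeal_iff {n : ℕ} {x : S} (hx : x ∈ F (n : ℤ)) :
    homog F n x hx ∈ inftyIdeal F ↔ x ∈ F ((n : ℤ) - 1) := by
  refine ⟨fun h => ?_, fun h m => ?_⟩
  · have := h n
    rwa [component_homog_self] at this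
  · by_cases hm : n = m
    · subst hm
      rwa [component_homog_self]
    · rw [component_homog_of_ne F hm]
      exact zero_mem _

theorem inftyIdeal_isHomogeneous : (inftyIdeal F).IsHomogeneous (grading F) := by
  intro n y hy
  rw [decompose_eq_homog, homog_mem_inftyIdeal_iff]
  exact hy n

/-- The element `1`, placed in degree `1`. -/
def degreeOne : GradedSum F := homog F 1 1 (one_mem_one F)

theorem degreeOne_mem : degreeOne F ∈ grading F 1 := homog_mem F 1 1 (one_mem_one F)

theorem degreeOne_mem_inftyIdeal : degreeOne F ∈ inftyIdeal F :=
  (homog_mem_inftyIdeal_iff F _).2 (by simpa using IsRingFiltration.one_mem (F := F))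

/-- Multiplication by `degreeOne` shifts the degree and leaves the underlying element of `S`
unchanged. -/
theorem degreeOne_mul_homog {n : ℕ} {x : S} (hx : x ∈ F (n : ℤ)) (hx' : x ∈ F ((n + 1 : ℕ) : ℤ)) :
    degreeOne F * homog F n x hx = homog F (n + 1) x hx' := by
  rw [degreeOne, homog_mul F _ _ _ _ _ _ (natPart_mul_mem F (one_mem_one F) hx)]
  exact homog_congr F (add_comm _ _) (one_mul x) _ _

theorem homog_mem_irrelevant {n : ℕ} (hn : 0 < n) {x : S} (hx : x ∈ F (n : ℤ)) :
    homog F n x hx ∈ HomogeneousIdeal.irrelevant (grading F) := by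
  rw [HomogeneousIdeal.mem_irrelevant_iff, GradedRing.proj_apply,
    DirectSum.decompose_of_mem_ne _ (homog_mem F n x hx) hn.ne']

theorem exists_homog_notMem (P : Proj (grading F)) :
    ∃ (n : ℕ) (_ : 0 < n) (x : S) (hx : x ∈ F (n : ℤ)),
      homog F n x hx ∉ P.asHomogeneousIdeal := by
  by_contra! h
  refine P.not_irrelevant_le fun y hy => ?_
  rw [HomogeneousIdeal.mem_irrelevant_iff, GradedRing.proj_apply] at hy
  refine (Ideal.IsHomogeneous.mem_iff (𝒜 := grading F) P.asHomogeneousIdeal.isHomogeneous).2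
    fun n => ?_
  rcases Nat.eq_zero_or_pos n with rfl | hn
  · rw [hy]
    exact zero_mem _
  · rw [decompose_eq_homog]
    exact h n hn _ _

variable {F}

/-- For homogeneous elements, lying outside the ideal means having the maximal pole order allowed by
the degree, and these orders add up in a product. -/
theorem IsPoleFiltration.inftyIdeal_isPrime (hF : IsPoleFiltration F) : (inftyIdeal F).IsPrime := by
  refine (inftyIdeal_isHomogeneous F).isPrime_of_homogeneous_mem_or_mem ?_ ?_
  · rw [Ideal.ne_top_iff_one]
    intro h
    exact hF.one_notMem ((homog_mem_inftyIdeal_iff F IsRingFiltration.one_mem).1 h)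
  · rintro y y' ⟨m, hm⟩ ⟨n, hn⟩ h
    obtain ⟨x, hx, rfl⟩ := exists_eq_homog F hm
    obtain ⟨x', hx', rfl⟩ := exists_eq_homog F hn
    rw [homog_mul F _ _ _ _ _ _ (natPart_mul_mem F hx hx'), homog_mem_inftyIdeal_iff] at h
    rw [homog_mem_inftyIdeal_iff, homog_mem_inftyIdeal_iff]
    by_contra! h'
    exact hF.mul_notMem _ _ _ _ hx h'.1 hx' h'.2 (by simpa using h)

/-- The point `⨁_{n ≥ 0} F (n - 1)` of `Proj (⨁_{n ≥ 0} F n)`. -/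
def IsPoleFiltration.inftyPoint (hF : IsPoleFiltration F) : Proj (grading F) :=
  ProjectiveSpectrum.mk ⟨inftyIdeal F, inftyIdeal_isHomogeneous F⟩ hF.inftyIdeal_isPrime
    fun h => by
      obtain ⟨n, hn, x, hx, hx'⟩ := hF.exists_pos
      exact hx' ((homog_mem_inftyIdeal_iff F hx).1 (h (homog_mem_irrelevant F hn hx)))

theorem IsPoleFiltration.homog_mem_inftyPoint_iff (hF : IsPoleFiltration F) {n : ℕ} {x : S}
    (hx : x ∈ F (n : ℤ)) :
    homog F n x hx ∈ hF.inftyPoint.asHomogeneousIdeal ↔ x ∈ F ((n : ℤ) - 1) :=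
  homog_mem_inftyIdeal_iff F hx

theorem ext_of_homog_mem {P Q : Proj (grading F)}
    (h : ∀ (n : ℕ) (x : S) (hx : x ∈ F (n : ℤ)),
      homog F n x hx ∈ P.asHomogeneousIdeal ↔ homog F n x hx ∈ Q.asHomogeneousIdeal) : P = Q := by
  refine ProjectiveSpectrum.ext (HomogeneousIdeal.toIdeal_injective (Ideal.ext fun y => ?_))
  rw [Ideal.IsHomogeneous.mem_iff (𝒜 := grading F) P.asHomogeneousIdeal.isHomogeneous,
    Ideal.IsHomogeneous.mem_iff (𝒜 := grading F) Q.asHomogeneousIdeal.isHomogeneous]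
  refine forall_congr' fun n => ?_
  rw [decompose_eq_homog]
  exact h _ _ _

/-- Containing `degreeOne` forces all elements of non-maximal order into `P`. One further
homogeneous element in `P` would drag in, up to powers and lower order, every element of positive
degree. -/
theorem IsPoleFiltration.eq_inftyPoint_of_mem (hF : IsPoleFiltration F) {P : Proj (grading F)}
    (hP : degreeOne F ∈ P.asHomogeneousIdeal) : P = hF.inftyPoint := by
  obtain ⟨m, hm, y, hy, hyP⟩ := exists_homog_notMem F P
  have hpos : ∀ (n : ℕ) (x : S) (hx : x ∈ F (n : ℤ)), 0 < n → x ∈ F ((n : ℤ) - 1) →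
      homog F n x hx ∈ P.asHomogeneousIdeal.toIdeal := by
    intro n x hx hn hx'
    obtain ⟨n, rfl⟩ : ∃ k, n = k + 1 := ⟨n - 1, by omega⟩
    have h1 : x ∈ F (n : ℤ) := by simpa using hx'
    rw [← degreeOne_mul_homog F h1 hx]
    exact Ideal.mul_mem_right _ _ hP
  have hall : ∀ (n : ℕ) (x : S) (hx : x ∈ F (n : ℤ)), x ∈ F ((n : ℤ) - 1) →
      homog F n x hx ∈ P.asHomogeneousIdeal.toIdeal := by
    intro n x hx hx'
    -- In degree `0` one cannot divide by `degreeOne`, so `x` is first multiplied by the element `y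
    -- ∉ P` of positive degree. In this way `F (-1) = 0` need not be known.
    have h1 := hpos (n + m) (x * y) (natPart_mul_mem F hx hy) (by omega) (by
      have := natPart_mul_pred F hy hx'
      rwa [mul_comm, add_comm n m])
    rw [← homog_mul F n m x y hx hy] at h1
    exact (P.isPrime.mem_or_mem h1).resolve_right hyP
  refine ext_of_homog_mem fun n x hx => ?_
  rw [hF.homog_mem_inftyPoint_iff]
  refine ⟨fun h => ?_, hall n x hx⟩
  by_contra hx'
  have hpow : ∀ k : ℕ, x ^ k ∉ F (((k * n : ℕ) : ℤ) - 1) := by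
    intro k
    induction k with
    | zero => simpa using hF.one_notMem
    | succ k ih =>
      have := hF.mul_notMem _ n _ _ (natPart_pow_mem F hx k) ih hx hx'
      rw [pow_succ]
      convert this using 3
      push_cast
      ring
  have hyn : y ^ n ∈ F ((m * n : ℕ) : ℤ) := by
    rw [mul_comm m n]
    exact natPart_pow_mem F hy n
  have hxm := natPart_pow_mem F hx m
  -- `yⁿ` and `xᵐ` both have degree `mn`, and `xᵐ` has maximal order there. So `yⁿ` is a multiple of
  -- `xᵐ ∈ P` plus an element of lower order, also in `P`; this contradicts `y ∉ P`.
  obtain ⟨c, hc⟩ := hF.exists_sub_smul_mem _ (y ^ n) (x ^ m) hyn hxm (hpow m)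
  have h2 : homog F (m * n) (x ^ m) hxm ∈ P.asHomogeneousIdeal.toIdeal := by
    rw [← homog_pow]
    exact Ideal.pow_mem_of_mem _ h m hm
  have h5 := P.asHomogeneousIdeal.toIdeal.add_mem
    (hall _ _ (sub_mem hyn ((F _).smul_mem c hxm)) hc) (homog_smul_mem F hxm c h2)
  rw [homog_add, homog_congr F (mul_comm m n) (sub_add_cancel (y ^ n) (c • x ^ m)) _
    (natPart_pow_mem F hy n), ← homog_pow F hy] at h5
  exact hyP (P.isPrime.mem_of_pow_mem n h5)

end Algebra

/-! ### Affine charts of `Proj` and their points. -/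

section Proj

open CategoryTheory HomogeneousLocalization

variable {A : Type u} [CommRing A] {σ : Type*} [SetLike σ A] [AddSubgroupClass σ A]
  (𝒜 : ℕ → σ) [GradedRing 𝒜]

theorem exists_isIso_fromOfGlobalSections_eq {X : Scheme.{u}} [IsAffine X] (f : A →+* Γ(X, ⊤))
    (hf : (HomogeneousIdeal.irrelevant 𝒜).toIdeal.map f = ⊤) {t : A} {d : ℕ} (h0d : 0 < d)
    (hd : t ∈ 𝒜 d) (ht : IsUnit (f t)) (hb : Function.Bijective (awayLift 𝒜 f ht)) :
    ∃ (g : X ⟶ Spec (.of (Away 𝒜 t))) (_ : IsIso g),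
      Proj.fromOfGlobalSections 𝒜 f hf = CategoryStruct.comp g (Proj.awayι 𝒜 t hd h0d) := by
  have hiso : IsIso (CommRingCat.ofHom (awayLift 𝒜 f ht)) :=
    (ConcreteCategory.isIso_iff_bijective _).2 hb
  refine ⟨CategoryStruct.comp X.toSpecΓ (Spec.map (CommRingCat.ofHom (awayLift 𝒜 f ht))),
    inferInstance, ?_⟩
  rw [Category.assoc]
  exact fromOfGlobalSections_eq_toSpecΓ_comp 𝒜 f hf h0d hd ht

/-- The preimage of `D₊(g)` in the chart is the nonvanishing locus of `gᵈ / fᵏᵈ`, which is the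
`d`-th power of `g / fᵏ`; a prime does not distinguish the two. -/
theorem mk_mem_iff_mem_awayι {f : A} {d : ℕ} (hf : f ∈ 𝒜 d) (hd : 0 < d) {k : ℕ} (hk : 0 < k)
    {g : A} (hg : g ∈ 𝒜 (k • d)) (𝔪 : Spec (.of (Away 𝒜 f))) :
    Away.mk 𝒜 hf k g hg ∈ 𝔪.asIdeal ↔ g ∈ (Proj.awayι 𝒜 f hf hd 𝔪).asHomogeneousIdeal := by
  have h := Proj.awayι_preimage_basicOpen 𝒜 hf hd hg (Nat.mul_pos hk hd)
  have h2 : 𝔪 ∈ Proj.awayι 𝒜 f hf hd ⁻¹ᵁ Proj.basicOpen 𝒜 g ↔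
        𝔪 ∈ PrimeSpectrum.basicOpen (Away.isLocalizationElem hf hg) := by
    rw [← h]; rfl
  replace h2 : g ∉ (Proj.awayι 𝒜 f hf hd 𝔪).asHomogeneousIdeal ↔
    Away.isLocalizationElem hf hg ∉ 𝔪.asIdeal := h2
  refine Iff.trans ?_ (not_iff_not.1 h2).symm
  have h3 : Away.isLocalizationElem hf hg = Away.mk 𝒜 hf k g hg ^ d := by
    apply HomogeneousLocalization.val_injective
    rw [HomogeneousLocalization.val_pow, Away.val_mk, Away.val_mk, Localization.mk_pow]
    congr 1
    exact Subtype.ext (pow_mul f k d)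
  rw [h3]
  exact ⟨fun h => Ideal.pow_mem_of_mem _ h d hd, fun h => 𝔪.isPrime.mem_of_pow_mem d h⟩

end Proj

/-! ### The chart `D₊(T)` is `Spec S`, and the point at infinity is closed in its charts. -/

section Algebra

open CategoryTheory HomogeneousLocalization

variable {S : Type u} [CommRing S] [Algebra ℂ S] (F : ℤ → Submodule ℂ S) [IsRingFiltration F]

/-- The fraction `x / Tⁿ`, with `T = degreeOne`, goes to `θ x` because `T` goes to `1`. Surjectivity
is the exhaustiveness of the filtration. -/
theorem bijective_awayLift (hex : ∀ x : S, ∃ n : ℕ, x ∈ F (n : ℤ)) {R : Type*} [CommRing R]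
    {θ : S →+* R} (hθ : Function.Bijective θ) (hu : IsUnit (θ.comp (sumHom F) (degreeOne F))) :
    Function.Bijective (awayLift (grading F) (θ.comp (sumHom F)) hu) := by
  have hT : θ.comp (sumHom F) (degreeOne F) = 1 := by
    rw [RingHom.comp_apply, degreeOne, sumHom_homog, map_one]
  have key : ∀ (n : ℕ) (x : S) (hx : x ∈ F (n : ℤ)) (hx' : homog F n x hx ∈ grading F (n • 1)),
      awayLift (grading F) (θ.comp (sumHom F)) hu
        (Away.mk (grading F) (degreeOne_mem F) n (homog F n x hx) hx') = θ x := by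
    intro n x hx hx'
    have := awayLift_mk_mul (grading F) (θ.comp (sumHom F)) hu (degreeOne_mem F) n _ hx'
    rwa [hT, one_pow, mul_one, RingHom.comp_apply, sumHom_homog] at this
  constructor
  · rw [injective_iff_map_eq_zero]
    intro y hy
    obtain ⟨n, y, hy', rfl⟩ := Away.mk_surjective (grading F) (degreeOne_mem F) y
    have hy'' : y ∈ grading F n := by simpa using hy'
    obtain ⟨x, hx, rfl⟩ := exists_eq_homog F hy''
    rw [key, map_eq_zero_iff _ hθ.1] at hy
    subst hy
    apply HomogeneousLocalization.val_injective
    rw [Away.val_mk, HomogeneousLocalization.val_zero]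
    have : homog F n 0 hx = 0 := (inclusion F n).map_zero
    rw [this, Localization.mk_zero]
  · intro r
    obtain ⟨x, rfl⟩ := hθ.2 r
    obtain ⟨n, hx⟩ := hex x
    exact ⟨_, key n x hx (by simpa using homog_mem F n x hx)⟩

theorem bijective_ΓSpecIso_inv (S : Type u) [CommRing S] :
    Function.Bijective (Scheme.ΓSpecIso (.of S)).inv.hom :=
  ConcreteCategory.bijective_of_isIso (Scheme.ΓSpecIso (.of S)).inv

theorem exists_isIso_specToProj_eq (hex : ∀ x : S, ∃ n : ℕ, x ∈ F (n : ℤ)) :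
    ∃ (g : Spec (.of S) ⟶ Spec (.of (Away (grading F) (degreeOne F)))) (_ : IsIso g),
      specToProj F = g ≫ Proj.awayι (grading F) (degreeOne F) (degreeOne_mem F) one_pos := by
  let f : GradedSum F →+* Γ(Spec (.of S), ⊤) :=
    ((Scheme.ΓSpecIso (.of S)).inv.hom).comp (sumHom F)
  have hu : IsUnit (f (degreeOne F)) := by
    rw [RingHom.comp_apply, degreeOne, sumHom_homog, map_one]
    exact isUnit_one
  exact exists_isIso_fromOfGlobalSections_eq (grading F) f (map_irrelevant_eq_top F) one_pos
    (degreeOne_mem F) hu (bijective_awayLift F hex (R := Γ(Spec (.of S), ⊤))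
      (θ := (Scheme.ΓSpecIso (.of S)).inv.hom) (bijective_ΓSpecIso_inv S) hu)

theorem isOpenImmersion_specToProj (hex : ∀ x : S, ∃ n : ℕ, x ∈ F (n : ℤ)) :
    IsOpenImmersion (specToProj F) := by
  obtain ⟨g, _, h⟩ := exists_isIso_specToProj_eq F hex
  rw [h]
  infer_instance

theorem range_specToProj (hex : ∀ x : S, ∃ n : ℕ, x ∈ F (n : ℤ)) :
    Set.range (specToProj F) = Proj.basicOpen (grading F) (degreeOne F) := by
  obtain ⟨g, _, h⟩ := exists_isIso_specToProj_eq F hex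
  rw [h]
  exact congrArg (fun U : (Proj (grading F)).Opens => (U : Set (Proj (grading F))))
    ((Scheme.Hom.opensRange_comp_of_isIso g _).trans (Proj.opensRange_awayι _ _ _ _))

omit [Algebra ℂ S] in
theorem bijective_specSection {V : (Spec (.of S)).Opens} (hV : V = ⊤) :
    Function.Bijective (specSection V) := by
  subst hV
  have h : ((Spec (.of S)).presheaf.map (homOfLE (le_refl (⊤ : (Spec (.of S)).Opens))).op) =
      𝟙 _ := (Spec (.of S)).presheaf.map_id _
  have h2 : specSection (⊤ : (Spec (.of S)).Opens) = (Scheme.ΓSpecIso (.of S)).inv.hom := by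
    rw [specSection]
    erw [h]
    rfl
  rw [h2]
  exact bijective_ΓSpecIso_inv S

theorem exists_ringEquiv_section (hex : ∀ x : S, ∃ n : ℕ, x ∈ F (n : ℤ)) :
    ∃ σ : Γ(Proj (grading F), Proj.basicOpen (grading F) (degreeOne F)) ≃+* S,
      ∀ s, (specToProj F).app (Proj.basicOpen (grading F) (degreeOne F)) s =
        specSection (specToProj F ⁻¹ᵁ Proj.basicOpen (grading F) (degreeOne F)) (σ s) := by
  set U := Proj.basicOpen (grading F) (degreeOne F)
  have := isOpenImmersion_specToProj F hex
  have hr := range_specToProj F hex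
  -- The open set is exactly the range of the open immersion, so its preimage is everything and
  -- pullback of sections is bijective.
  have hU : specToProj F ⁻¹ᵁ U = ⊤ := by
    ext x
    have : specToProj F x ∈ (U : Set (Proj (grading F))) := hr ▸ Set.mem_range_self x
    simpa using this
  have hiso : IsIso ((specToProj F).app U) :=
    Scheme.Hom.isIso_app _ _ fun x hx => by
      have : x ∈ (U : Set (Proj (grading F))) := hx
      rwa [← hr] at this
  refine ⟨(asIso ((specToProj F).app U)).commRingCatIsoToRingEquiv.trans
    (RingEquiv.ofBijective (specSection (specToProj F ⁻¹ᵁ U)) (bijective_specSection hU)).symm,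
    fun s => ?_⟩
  exact ((RingEquiv.ofBijective (specSection (specToProj F ⁻¹ᵁ U))
    (bijective_specSection hU)).apply_symm_apply _).symm

variable {F}

theorem IsPoleFiltration.basicOpen_degreeOne (hF : IsPoleFiltration F) :
    (Proj.basicOpen (grading F) (degreeOne F) : Set (Proj (grading F))) = {hF.inftyPoint}ᶜ := by
  ext P
  refine not_congr ⟨fun h => hF.eq_inftyPoint_of_mem h, ?_⟩
  rintro rfl
  exact degreeOne_mem_inftyIdeal F

/-- A fraction outside `𝔪` has a numerator of maximal order. Some constant multiple of it therefore
differs from `1` by an element of `𝔪`. -/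
theorem IsPoleFiltration.isMaximal_of_awayι_eq (hF : IsPoleFiltration F) {m : ℕ} (hm : 0 < m)
    {a : S} (ha : a ∈ F (m : ℤ))
    (𝔪 : Spec (.of (Away (grading F) (homog F m a ha))))
    (h𝔪 : Proj.awayι (grading F) (homog F m a ha) (homog_mem F m a ha) hm 𝔪 = hF.inftyPoint) :
    𝔪.asIdeal.IsMaximal := by
  have hmem : ∀ (k : ℕ) (_ : 0 < k) (x : S) (hx : x ∈ F ((k * m : ℕ) : ℤ)),
      Away.mk (grading F) (homog_mem F m a ha) k (homog F (k * m) x hx)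
        (homog_mem F (k * m) x hx) ∈ 𝔪.asIdeal ↔ x ∈ F (((k * m : ℕ) : ℤ) - 1) := by
    intro k hk x hx
    rw [mk_mem_iff_mem_awayι (grading F) (homog_mem F m a ha) hm hk, h𝔪,
      hF.homog_mem_inftyPoint_iff]
  rw [Ideal.isMaximal_iff]
  refine ⟨fun h => 𝔪.isPrime.ne_top ((Ideal.eq_top_iff_one _).2 h), fun J x hJ hx hxJ => ?_⟩
  obtain ⟨n, b, hb, rfl⟩ := Away.mk_surjective (grading F) (homog_mem F m a ha) x
  obtain ⟨b, hb', rfl⟩ := exists_eq_homog F hb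
  have hba : b * a ∈ F (((n + 1) * m : ℕ) : ℤ) := by
    rw [add_mul, one_mul]
    exact natPart_mul_mem F hb' ha
  -- Expanding the fraction by `a` makes the exponent of the denominator positive, as the membership
  -- criterion `hmem` requires.
  have hx1 : Away.mk (grading F) (homog_mem F m a ha) n (homog F (n • m) b hb') hb =
      Away.mk (grading F) (homog_mem F m a ha) (n + 1) (homog F ((n + 1) * m) (b * a) hba)
        (homog_mem F ((n + 1) * m) _ hba) := by
    apply HomogeneousLocalization.val_injective
    rw [Away.val_mk, Away.val_mk, Localization.mk_eq_mk_iff, Localization.r_iff_exists]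
    refine ⟨1, ?_⟩
    have : homog F (n • m) b hb' * homog F m a ha = homog F ((n + 1) * m) (b * a) hba := by
      rw [homog_mul F _ _ _ _ _ _ (natPart_mul_mem F hb' ha)]
      exact homog_congr F (by rw [smul_eq_mul]; ring) rfl _ _
    simp only [← this, pow_succ]
    ring
  rw [hx1] at hx hxJ
  rw [hmem _ n.add_one_pos] at hx
  obtain ⟨c, hc⟩ := hF.exists_sub_smul_mem _ (a ^ (n + 1)) (b * a)
    (natPart_pow_mem F ha (n + 1)) hba hx
  have hmem1 : a ^ (n + 1) - c • (b * a) ∈ F (((n + 1) * m : ℕ) : ℤ) :=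
    sub_mem (natPart_pow_mem F ha (n + 1)) ((F _).smul_mem c hba)
  have hc0 : algebraMap ℂ S c ∈ F ((0 * m : ℕ) : ℤ) := by
    rw [Algebra.algebraMap_eq_smul_one, zero_mul]
    exact (F _).smul_mem c IsRingFiltration.one_mem
  have h1 := J.add_mem (hJ ((hmem _ n.add_one_pos _ hmem1).2 hc))
    (J.mul_mem_left (Away.mk (grading F) (homog_mem F m a ha) 0 (homog F (0 * m) _ hc0)
      (homog_mem F (0 * m) _ hc0)) hxJ)
  convert h1 using 1
  apply HomogeneousLocalization.val_injective
  rw [HomogeneousLocalization.val_one, HomogeneousLocalization.val_add,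
    HomogeneousLocalization.val_mul, Away.val_mk, Away.val_mk, Away.val_mk, Localization.mk_mul,
    homog_mul F _ _ _ _ _ _ (natPart_mul_mem F hc0 hba)]
  have h2 : homog F (0 * m + (n + 1) * m) _ (natPart_mul_mem F hc0 hba) =
      homog F ((n + 1) * m) _ ((F _).smul_mem c hba) :=
    homog_congr F (by ring) (Algebra.smul_def c _).symm _ _
  have h3 : (⟨homog F m a ha ^ 0, 0, rfl⟩ * ⟨homog F m a ha ^ (n + 1), n + 1, rfl⟩ :
      Submonoid.powers (homog F m a ha)) = ⟨homog F m a ha ^ (n + 1), n + 1, rfl⟩ :=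
    Subtype.ext (by simp)
  rw [h2, h3]
  refine Eq.trans ?_ (Localization.add_mk_self _ _ _).symm
  rw [homog_add, homog_congr F rfl (sub_add_cancel _ _) _ (natPart_pow_mem F ha (n + 1)),
    ← homog_pow F ha]
  exact (Localization.mk_self_mk _ _).symm

/-- The class of any element of exact order `n` spans the quotient, by comparison of leading terms.
-/
theorem IsPoleFiltration.stepDim_eq_one (hF : IsPoleFiltration F) {n : ℤ}
    (h : ∃ x ∈ F n, x ∉ F (n - 1)) : stepDim F n = 1 := by
  obtain ⟨y, hy, hy'⟩ := h
  rw [stepDim, finrank_eq_one_iff']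
  refine ⟨Submodule.Quotient.mk ⟨y, hy⟩, ?_, fun w => ?_⟩
  · rw [Ne, Submodule.Quotient.mk_eq_zero]
    exact hy'
  · obtain ⟨⟨x, hx⟩, rfl⟩ := Submodule.Quotient.mk_surjective _ w
    obtain ⟨c, hc⟩ := hF.exists_sub_smul_mem n x y hx hy hy'
    refine ⟨c, ?_⟩
    rw [← Submodule.Quotient.mk_smul, eq_comm, Submodule.Quotient.eq]
    exact hc

end Algebra

/-! ### Leading coefficients of meromorphic germs. -/

section LeadingCoefficient

open Filter

/-- Two functions with the same pole order agree to leading order, up to a constant. -/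
theorem exists_lt_meromorphicOrderAt_sub_const_mul {f g : ℂ → ℂ} {k : ℤ} (hf : MeromorphicAt f 0)
    (hg : MeromorphicAt g 0) (hfk : (k : WithTop ℤ) ≤ meromorphicOrderAt f 0)
    (hgk : meromorphicOrderAt g 0 = k) :
    ∃ c : ℂ, (k : WithTop ℤ) < meromorphicOrderAt (fun w => f w - c * g w) 0 := by
  have hgne : ∀ᶠ w in 𝓝[≠] (0 : ℂ), g w ≠ 0 :=
    (meromorphicOrderAt_ne_top_iff_eventually_ne_zero hg).1 (by simp [hgk])
  have hq : MeromorphicAt (f * g⁻¹) 0 := hf.mul hg.inv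
  have hq0 : 0 ≤ meromorphicOrderAt (f * g⁻¹) 0 := by
    rw [meromorphicOrderAt_mul hf hg.inv, meromorphicOrderAt_inv, hgk]
    calc (0 : WithTop ℤ) = k + -(k : WithTop ℤ) := by
          norm_cast
          simp
      _ ≤ _ := by gcongr
  -- The constant is the limit of `f / g` at `0`; it exists because the quotient has nonnegative
  -- order.
  obtain ⟨c, hc⟩ := tendsto_nhds_of_meromorphicOrderAt_nonneg hq hq0
  refine ⟨c, ?_⟩
  have hr : MeromorphicAt (fun w => (f * g⁻¹) w - c) 0 := hq.sub (MeromorphicAt.const c 0)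
  have h1 : 0 < meromorphicOrderAt (fun w => (f * g⁻¹) w - c) 0 := by
    rw [← tendsto_zero_iff_meromorphicOrderAt_pos hr]
    simpa using hc.sub_const c
  have h2 : (fun w => f w - c * g w) =ᶠ[𝓝[≠] 0] g * fun w => (f * g⁻¹) w - c := by
    filter_upwards [hgne] with w hw
    simp only [Pi.mul_apply, Pi.inv_apply]
    field_simp
  rw [meromorphicOrderAt_congr h2, meromorphicOrderAt_mul hg hr, hgk]
  cases h : meromorphicOrderAt (fun w => (f * g⁻¹) w - c) 0 with
  | top => simp
  | coe n =>
    rw [h] at h1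
    norm_cast at h1 ⊢
    omega

theorem WithTop.add_one_le_iff_lt {a : ℤ} {b : WithTop ℤ} :
    ((a + 1 : ℤ) : WithTop ℤ) ≤ b ↔ (a : WithTop ℤ) < b := by
  cases b with
  | top => simp
  | coe n => norm_cast

end LeadingCoefficient

/-! ### The pole filtration of `R_e` satisfies the axioms. -/

section Surface

set_option linter.unusedSectionVars false

open Filter

variable {C : Type u} [TopologicalSpace C] [T2Space C] [ChartedSpace ℂ C] {p : C}
  {z : LocalCoordinate p} {L : C → Type v} [TopologicalSpace (TotalSpace ℂ L)]
  [∀ x, AddCommGroup (L x)] [∀ x, Module ℂ (L x)] [∀ x, TopologicalSpace (L x)]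
  [FiberBundle ℂ L] [VectorBundle ℂ ℂ L] {M N : ℕ} (D : VertexData z M N) (e : ∀ x : C, L x)

theorem notMem_poleFiltration_iff {n : ℤ} {f : stabilizerRing D e} (hf : f ∈ poleFiltration D e n) :
    f ∉ poleFiltration D e (n - 1) ↔
      meromorphicOrderAt (localExpr z f.1) 0 = ((-n : ℤ) : WithTop ℤ) := by
  rw [mem_poleFiltration_iff] at hf ⊢
  rw [neg_sub, sub_eq_neg_add, WithTop.add_one_le_iff_lt, not_lt]
  exact ⟨fun h => le_antisymm h hf, fun h => h.le⟩

theorem localExpr_sub_smul (f g : punctured p → ℂ) (c : ℂ) :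
    localExpr z (f - c • g) = fun w => localExpr z f w - c * localExpr z g w := by
  ext w
  simp only [localExpr]
  split_ifs <;> simp

/-- A function of the affine ring that vanishes at all the points `p_i` and `q_j` lies in the
stabilizer ring. -/
theorem mem_stabilizerRing_of_vanishing {f : punctured p → ℂ} (hf : f ∈ affineRing z)
    (hp : ∀ i, localExpr z f (D.p i) = 0) (hq : ∀ j, localExpr z f (D.q j) = 0) :
    f ∈ stabilizerRing D e := by
  refine ⟨hf, ?_⟩
  rintro s ⟨⟨hs, -⟩, A, ⟨hA, hsA⟩, hrel⟩
  have hexp : IsExpansion z e (fun x => f x • s x) fun w => localExpr z f w * A w := by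
    refine ⟨hf.2.mul hA, fun x hx => ?_⟩
    have h1 : z.chart.symm (z.chart x) ∈ punctured p := by
      rw [z.chart.left_inv hx]
      exact x.2
    have h2 : (⟨z.chart.symm (z.chart x), h1⟩ : punctured p) = x :=
      Subtype.ext (z.chart.left_inv hx)
    have h3 : localExpr z f (z.chart x) = f x := by
      rw [localExpr, dif_pos h1, h2]
    simp only [h3, hsA x hx, mul_smul]
  refine ⟨⟨hs.smul hf.1, _, hexp⟩, _, hexp, fun i => ?_⟩
  -- The expansion of `f s` vanishes at every `p_i` and every `q_j`, so each relation reads `0 = 0`,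
  -- whatever the coefficients.
  simp [hp, hq]

variable [CompactSpace C] [IsManifold 𝓘(ℂ) ω C]

theorem symm_mem_punctured {w : ℂ} (hw : w ∈ z.chart.target) (hw0 : w ≠ 0) :
    z.chart.symm w ∈ punctured p := fun h => hw0 (by
  have h' : z.chart.symm w = p := h
  rw [← z.chart.right_inv hw, h', z.map_center])

theorem exists_mem_poleFiltration_notMem : ∃ N₀ : ℕ, ∀ n : ℕ, N₀ ≤ n →
    ∃ f ∈ poleFiltration D e (n : ℤ), f ∉ poleFiltration D e ((n : ℤ) - 1) := by
  let q : Fin N ⊕ Fin M → punctured p := Sum.elim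
    (fun i => ⟨z.chart.symm (D.p i), symm_mem_punctured (D.p_mem i) (D.p_ne_zero i)⟩)
    (fun j => ⟨z.chart.symm (D.q j), symm_mem_punctured (D.q_mem j) (D.q_ne_zero j)⟩)
  obtain ⟨N₀, h⟩ := exists_vanishing_of_large z q
  refine ⟨N₀, fun n hn => ?_⟩
  obtain ⟨f, hf, hf0, hord⟩ := h n hn
  have hmem : f ∈ stabilizerRing D e := by
    refine mem_stabilizerRing_of_vanishing D e hf (fun i => ?_) fun j => ?_
    · rw [localExpr, dif_pos (symm_mem_punctured (D.p_mem i) (D.p_ne_zero i))]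
      exact hf0 (Sum.inl i)
    · rw [localExpr, dif_pos (symm_mem_punctured (D.q_mem j) (D.q_ne_zero j))]
      exact hf0 (Sum.inr j)
  have h1 : (⟨f, hmem⟩ : stabilizerRing D e) ∈ poleFiltration D e (n : ℤ) := hord.ge
  exact ⟨⟨f, hmem⟩, h1, (notMem_poleFiltration_iff D e h1).2 hord⟩

theorem isPoleFiltration_poleFiltration : IsPoleFiltration (poleFiltration D e) where
  exists_sub_smul_mem n x y hx hy hy' := by
    obtain ⟨c, hc⟩ := exists_lt_meromorphicOrderAt_sub_const_mul
      (stabilizerRing_meromorphicAt D e x) (stabilizerRing_meromorphicAt D e y) hx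
      ((notMem_poleFiltration_iff D e hy).1 hy')
    refine ⟨c, ?_⟩
    rw [mem_poleFiltration_iff, neg_sub, sub_eq_neg_add, WithTop.add_one_le_iff_lt]
    change _ < meromorphicOrderAt (localExpr z (x.1 - c • y.1)) 0
    rwa [localExpr_sub_smul]
  mul_notMem m n x y hx hx' hy hy' := by
    rw [notMem_poleFiltration_iff D e (IsRingFiltration.mul_mem hx hy)]
    change meromorphicOrderAt (localExpr z (x.1 * y.1)) 0 = _
    rw [localExpr_mul, meromorphicOrderAt_mul (stabilizerRing_meromorphicAt D e x)
      (stabilizerRing_meromorphicAt D e y), (notMem_poleFiltration_iff D e hx).1 hx',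
      (notMem_poleFiltration_iff D e hy).1 hy', ← WithTop.coe_add, neg_add]
  one_notMem := by
    classical
    have h := (notMem_poleFiltration_iff D e (n := 0) (f := 1) IsRingFiltration.one_mem).2 (by
      change meromorphicOrderAt (localExpr z fun _ => (1 : ℂ)) 0 = _
      rw [meromorphicOrderAt_congr (localExpr_const z 1), meromorphicOrderAt_const]
      simp)
    simpa using h
  exists_pos := by
    obtain ⟨N₀, h⟩ := exists_mem_poleFiltration_notMem D e
    -- The successor guarantees a positive degree even if `N₀ = 0`.
    exact ⟨N₀ + 1, N₀.succ_pos, h (N₀ + 1) N₀.le_succ⟩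
  exhaustive x := by
    simp only [mem_poleFiltration_iff]
    cases h : meromorphicOrderAt (localExpr z x.1) 0 with
    -- A function that vanishes identically near `p` has order `⊤` and lies in every step.
    | top => exact ⟨0, le_top⟩
    | coe k =>
      refine ⟨k.natAbs, ?_⟩
      norm_cast
      exact neg_abs_le k

/-- The remainder has order at least `1 - m`, so `z⁻ᵐ` dominates and the pole order is exactly `m`.
-/
theorem notMem_poleFiltration_of_hasLeadingTerm {m : ℕ} {a : stabilizerRing D e}
    (ha : a ∈ poleFiltration D e (m : ℤ)) (h : HasLeadingTerm D e a m) :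
    a ∉ poleFiltration D e ((m : ℤ) - 1) := by
  rw [notMem_poleFiltration_iff D e ha]
  have hm : MeromorphicAt (fun w : ℂ => w ^ (-(m : ℤ))) 0 := (MeromorphicAt.id 0).zpow _
  have h1 : localExpr z a.1 =
      (fun w => localExpr z a.1 w - w ^ (-(m : ℤ))) + fun w => w ^ (-(m : ℤ)) := by
    ext w
    simp
  have h2 : ((-(m : ℤ) : ℤ) : WithTop ℤ) <
      meromorphicOrderAt (fun w => localExpr z a.1 w - w ^ (-(m : ℤ))) 0 := by
    rw [← WithTop.add_one_le_iff_lt, neg_add_eq_sub]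
    exact h
  rw [h1, meromorphicOrderAt_add_eq_right_of_lt, meromorphicOrderAt_inv_pow]
  · exact (stabilizerRing_meromorphicAt D e a).sub hm
  · rwa [meromorphicOrderAt_inv_pow]

end Surface

end SingularCurve

end

open SingularCurve

theorem mainTheorem2 {C : Type u} [TopologicalSpace C] [T2Space C] [CompactSpace C]
    [ConnectedSpace C] [ChartedSpace ℂ C] [IsManifold 𝓘(ℂ) ω C]
    (p : C) (z : LocalCoordinate p)
    {L : C → Type v} [TopologicalSpace (TotalSpace ℂ L)] [∀ x, AddCommGroup (L x)]
    [∀ x, Module ℂ (L x)] [∀ x, TopologicalSpace (L x)] [FiberBundle ℂ L] [VectorBundle ℂ ℂ L]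
    [ContMDiffVectorBundle ω ℂ L 𝓘(ℂ)]
    (e : ∀ x : C, L x)
    (he : MDifferentiableOn 𝓘(ℂ) (𝓘(ℂ).prod 𝓘(ℂ)) (fun x : C => TotalSpace.mk' ℂ x (e x))
      z.chart.source)
    (he' : ∀ x ∈ z.chart.source, e x ≠ 0)
    {M N : ℕ} (D : VertexData z M N) :
    -- `dim R_e(n) / R_e(n-1) = 1` for all large `n`
    (∃ N₀ : ℕ, ∀ n : ℕ, N₀ ≤ n → stepDim (poleFiltration D e) (n : ℤ) = 1) ∧
    -- the ideal `p'_∞` is a point of `C'`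
    ∃ p' : singularCurve D e,
      p'.asHomogeneousIdeal.toIdeal = inftyIdeal (poleFiltration D e) ∧
      -- (i)
      p' ∉ Set.range (specToCurve D e) ∧
      -- (ii)
      Set.range (specToCurve D e) ∪ {p'} = Set.univ ∧
      -- (iii)
      (∃ U : (singularCurve D e).Opens, (U : Set (singularCurve D e)) = {p'}ᶜ ∧
        ∃ σ : Γ(singularCurve D e, U) ≃+* stabilizerRing D e, ∀ s : Γ(singularCurve D e, U),
          (specToCurve D e).app U s =
            specSection (specToCurve D e ⁻¹ᵁ U) (σ s)) ∧
      -- (iv)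
      ∀ (m : ℕ) (hm : 0 < m) (a : stabilizerRing D e) (ha : a ∈ poleFiltration D e (m : ℤ)),
        HasLeadingTerm D e a m →
        p' ∈ Proj.basicOpen (curveGrading D e) (homog (poleFiltration D e) m a ha) ∧
        ∃ 𝔪 : Spec (.of (HomogeneousLocalization.Away (curveGrading D e)
            (homog (poleFiltration D e) m a ha))),
          𝔪.asIdeal.IsMaximal ∧
          Proj.awayι (curveGrading D e) (homog (poleFiltration D e) m a ha)
            (homog_mem (poleFiltration D e) m a ha) hm 𝔪 = p' := by

  have hF := isPoleFiltration_poleFiltration D e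
  obtain ⟨N₀, hN⟩ := exists_mem_poleFiltration_notMem D e
  have hrange : Set.range (specToCurve D e) = {hF.inftyPoint}ᶜ :=
    (range_specToProj _ hF.exhaustive).trans hF.basicOpen_degreeOne
  refine ⟨⟨N₀, fun n hn => hF.stepDim_eq_one (hN n hn)⟩, hF.inftyPoint, rfl, ?_, ?_,
    ⟨Proj.basicOpen (curveGrading D e) (degreeOne (poleFiltration D e)), hF.basicOpen_degreeOne,
      exists_ringEquiv_section _ hF.exhaustive⟩, fun m hm a ha hlead => ?_⟩
  · rw [hrange]
    simp
  · rw [hrange, Set.compl_union_self]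
  · have hmem : hF.inftyPoint ∈
        Proj.basicOpen (curveGrading D e) (homog (poleFiltration D e) m a ha) := fun h =>
      notMem_poleFiltration_of_hasLeadingTerm D e ha hlead
        ((hF.homog_mem_inftyPoint_iff ha).1 h)
    refine ⟨hmem, ?_⟩
    -- `D'₊(a)` is the image of the chart `Spec A'_{(a)}`, so the point at infinity has a preimage
    -- `𝔪` there.
    rw [← Proj.opensRange_awayι (curveGrading D e) _ (homog_mem (poleFiltration D e) m a ha) hm]
      at hmem
    obtain ⟨𝔪, h𝔪⟩ := hmem
    exact ⟨𝔪, hF.isMaximal_of_awayι_eq hm ha 𝔪 h𝔪, h𝔪⟩
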